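/- Let $d\ge 0$, let $\varphi:\mathbb R^d\to\mathbb R$ be $K$-Lipschitz, and suppose that $y\mapsto\varphi(y)-\tfrac{\lambda}{2}|y|^2$ is concave for some $\lambda\ge0$. For $\varepsilon,t>0$ let $$u^\varepsilon_t(x)=-\varepsilon\log\left(\frac1{(2\pi\varepsilon t)^{d/2}}\int_{\mathbb R^d}\exp\Bigl(-\frac{|x-y|^2}{2\varepsilon t}-\frac{\varphi(y)}{\varepsilon}\Bigr)\,dy\right)$$ be the Cole-Hopf solution of $\partial_t u+\tfrac12|\nabla u|^2=\tfrac{\varepsilon}{2}\Delta u$ with initial value $\varphi$, let $v^\varepsilon_t=\nabla u^\varepsilon_t$, and let $X^\varepsilon_t(y)$, $t\ge0$, be the Lagrangian flow: for every $y\in\mathbb R^d$ the path $t\mapsto X^\varepsilon_t(y)$ is continuous on $[0,\infty)$, $X^\varepsilon_0(y)=y$, and $\partial_tX^\varepsilon_t(y)=v^\varepsilon_t(X^\varepsilon_t(y))$ for all $t>0$. Let $\rho^\varepsilon_t$ be the viscous mass measure, which has density $x\mapsto(\det\nabla X^\varepsilon_t(y))^{-1}$, $x=X^\varepsilon_t(y)$,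 with respect to Lebesgue measure $\mathcal L$ on $\mathbb R^d$; equivalently $\rho^\varepsilon_t=(X^\varepsilon_t)_\sharp\mathcal L$. Then the flows $X^\varepsilon$ exist for all $\varepsilon>0$, and $X^\varepsilon_t(y)$ converges as $\varepsilon\to0$, uniformly for $(y,t)$ in compact subsets of $\mathbb R^d\times[0,\infty)$, to a limit $X_t(y)$. For $t\ge0$ put $\rho_t=(X_t)_\sharp\mathcal L$. All measures $\rho^\varepsilon_t$ and $\rho_t$ are locally finite, and (i) for each $t\ge0$, $\rho^\varepsilon_t$ converges locally weak-$\star$ to $\rho_t$ as $\varepsilon\to0$; (ii) $\rho_t$ converges locally weak-$\star$ to $\mathcal L$ as $t\to0$. Here local weak-$\star$ convergence of measures $\mu^s\to\mu$ means $\int g\,d\mu^s\to\int g\,d\mu$ for every continuous $g:\mathbb R^d\to\mathbb R$ with compact support. -/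

import Mathlib

open MeasureTheory Filter Topology Set
open scoped NNReal ENNReal

namespace AdhesionModel

/-- A function is `lam`-concave if subtracting `(lam / 2) |y|²` makes it concave. -/
def LambdaConcave {d : ℕ} (lam : ℝ) (φ : EuclideanSpace ℝ (Fin d) → ℝ) : Prop :=
  ConcaveOn ℝ univ (fun y => φ y - lam / 2 * ‖y‖ ^ 2)

/-- The Cole-Hopf solution `u^ε_t(x)` of the potential Burgers equation
`∂ₜ u + |∇u|² / 2 = (ε / 2) Δ u` with initial value `φ`, for `ε, t > 0`. -/
noncomputable def colePotential {d : ℕ} (φ : EuclideanSpace ℝ (Fin d) → ℝ) (ε t : ℝ)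
    (x : EuclideanSpace ℝ (Fin d)) : ℝ :=
  -ε * Real.log (1 / (2 * Real.pi * ε * t) ^ ((d : ℝ) / 2) *
    ∫ y, Real.exp (-‖x - y‖ ^ 2 / (2 * ε * t) - φ y / ε))

/-- The viscous velocity field `v^ε_t = ∇ u^ε_t`. -/
noncomputable def velocity {d : ℕ} (φ : EuclideanSpace ℝ (Fin d) → ℝ) (ε t : ℝ)
    (x : EuclideanSpace ℝ (Fin d)) : EuclideanSpace ℝ (Fin d) :=
  gradient (colePotential φ ε t) x

/-- `Y y t` (for `t ≥ 0`) is the Lagrangian flow of the viscous velocity field: every path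
`t ↦ Y y t` is continuous on `[0, ∞)`, starts at `y`, and satisfies
`∂ₜ Y = v^ε_t(Y)` for all `t > 0`. The values at negative times play no role. -/
structure IsLagrangianFlow {d : ℕ} (φ : EuclideanSpace ℝ (Fin d) → ℝ) (ε : ℝ)
    (Y : EuclideanSpace ℝ (Fin d) → ℝ → EuclideanSpace ℝ (Fin d)) : Prop where
  initial : ∀ y, Y y 0 = y
  continuousOn : ∀ y, ContinuousOn (Y y) (Ici 0)
  hasDerivAt : ∀ y, ∀ t, 0 < t → HasDerivAt (Y y) (velocity φ ε t (Y y t)) t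

/-- The mass density transported by a diffeomorphism `F` from the uniform density `1`:
`x ↦ (det ∇F(y))⁻¹`, where `x = F(y)`. -/
noncomputable def transportedDensity {d : ℕ}
    (F : EuclideanSpace ℝ (Fin d) → EuclideanSpace ℝ (Fin d))
    (x : EuclideanSpace ℝ (Fin d)) : ℝ :=
  ((fderiv ℝ F (Function.invFun F x)).det)⁻¹

/-- The measure `ρ^ε_t` whose Lebesgue density is the mass density transported by the map
`F = X^ε_t`. -/
noncomputable def viscousMass {d : ℕ}
    (F : EuclideanSpace ℝ (Fin d) → EuclideanSpace ℝ (Fin d)) :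
    Measure (EuclideanSpace ℝ (Fin d)) :=
  volume.withDensity (fun x => ENNReal.ofReal (transportedDensity F x))

/-- Local weak-star convergence `μ s → ν` as `s → 0⁺`: convergence of the integrals of all
continuous functions with compact support (used for locally finite measures). -/
def LocallyWeakStarTendsto {d : ℕ} (μ : ℝ → Measure (EuclideanSpace ℝ (Fin d)))
    (ν : Measure (EuclideanSpace ℝ (Fin d))) : Prop :=
  ∀ g : EuclideanSpace ℝ (Fin d) → ℝ, Continuous g → HasCompactSupport g →
    Tendsto (fun s => ∫ x, g x ∂(μ s)) (𝓝[>] 0) (𝓝 (∫ x, g x ∂ν))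

end AdhesionModel

/-! The convergence of the flows rests on two facts about the Cole-Hopf potential. First,
`LambdaConcave.colePotential`: semiconcavity passes from φ to `u^ε_t` with the same constant,
because the logarithm of an integral of exponentials of convex functions is convex. Second,
`exists_abs_colePotential_sub_hopfLax_le`: for times up to T, `u^ε_t` is within o(1) of the Hopf-Lax
infimum, uniformly in space and time.

Adding the two tangent inequalities for `u^ε` and `u^δ` gives a one-sided bound between the two
velocity fields with error 2 sup |u^ε - u^δ| (`inner_velocity_sub_le`). Gronwall applied to |X^ε -
X^δ|² then makes the flows uniformly Cauchy on the whole space times [0, T]; no Lipschitz bound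
uniform in ε is needed.

For fixed ε the velocity may blow up like t^(-1/2) at time zero, since φ is only Lipschitz. In the
time s = √t the field becomes a multiple of a Gaussian mean that is bounded, continuous in s up to s
= 0, and Lipschitz in space uniformly on bounded s-intervals. This yields existence by
Picard-Lindelöf. It also shows that each flow map is a composition of small Lipschitz perturbations
of the identity, hence bi-Lipschitz with positive Jacobian almost everywhere, and the area formula
identifies the transported density with the pushforward (`viscousMass_eq_map`).

Finally |v^ε| ≤ K bounds all displacements by Kt. Measures are therefore locally finite, and both
weak-star limits follow by dominated convergence from pointwise convergence of the maps. -/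

namespace AdhesionModel

/-! ### Bi-Lipschitz maps with positive Jacobian, and their pushforwards of volume. -/

section OrientedBilipschitz

variable {E : Type*} [NormedAddCommGroup E] [NormedSpace ℝ E] [FiniteDimensional ℝ E]

/-- Along the segment from 1 to 1 + A every operator is invertible by the Neumann series, so the
determinant cannot change sign from its value 1. -/
theorem det_one_add_pos {A : E →L[ℝ] E} (hA : ‖A‖ < 1) : 0 < (1 + A).det := by
  have hne : ∀ s ∈ Icc (0 : ℝ) 1, (1 + s • A).det ≠ 0 := by
    intro s hs
    have h1 : ‖-(s • A)‖ < 1 := by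
      rw [norm_neg, norm_smul, Real.norm_of_nonneg hs.1]
      exact (mul_le_of_le_one_left (norm_nonneg _) hs.2).trans_lt hA
    have h2 : IsUnit (1 + s • A) := by
      simpa using isUnit_one_sub_of_norm_lt_one h1
    have h3 : IsUnit ((1 + s • A : E →L[ℝ] E) : E →ₗ[ℝ] E) :=
      h2.map (ContinuousLinearMap.toLinearMapRingHom : (E →L[ℝ] E) →+* (E →ₗ[ℝ] E))
    exact (LinearMap.isUnit_det _ h3).ne_zero
  have hcont : ContinuousOn (fun s : ℝ => (1 + s • A).det) (Icc 0 1) := by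
    apply Continuous.continuousOn
    exact ContinuousLinearMap.continuous_det.comp (by fun_prop)
  have h0 : (1 + (0 : ℝ) • A).det = 1 := by
    rw [zero_smul, add_zero]; exact LinearMap.det_id
  by_contra hneg
  rw [not_lt] at hneg
  have : (0 : ℝ) ∈ (fun s : ℝ => (1 + s • A).det) '' Icc 0 1 :=
    intermediate_value_Icc' zero_le_one hcont ⟨by simpa using hneg, by simp only [h0]; norm_num⟩
  obtain ⟨s, hs, hs0⟩ := this
  exact hne s hs hs0

variable [MeasurableSpace E] [BorelSpace E]

/-- Hausdorff measure of full dimension has the same null sets as Haar measure and behaves well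
under antilipschitz maps. Needed to pull the almost-everywhere condition on G back through F in a
composition. -/
theorem measure_preimage_eq_zero_of_antilipschitz (μ : Measure E) [μ.IsAddHaarMeasure]
    {F : E → E} {C : ℝ≥0} (hF : AntilipschitzWith C F) {s : Set E} (hs : μ s = 0) :
    μ (F ⁻¹' s) = 0 := by
  have h1 : μH[Module.finrank ℝ E] s = 0 :=
    Measure.absolutelyContinuous_isAddHaarMeasure (μH[Module.finrank ℝ E] : Measure E) μ hs
  refine Measure.absolutelyContinuous_isAddHaarMeasure μ (μH[Module.finrank ℝ E] : Measure E) ?_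
  have := hF.hausdorffMeasure_preimage_le (d := Module.finrank ℝ E) (by positivity) s
  rw [h1, mul_zero] at this
  exact le_antisymm this bot_le

theorem measure_image_eq_zero_of_lipschitz (μ : Measure E) [μ.IsAddHaarMeasure]
    {F : E → E} {C : ℝ≥0} (hF : LipschitzWith C F) {s : Set E} (hs : μ s = 0) :
    μ (F '' s) = 0 := by
  have h1 : μH[Module.finrank ℝ E] s = 0 :=
    Measure.absolutelyContinuous_isAddHaarMeasure (μH[Module.finrank ℝ E] : Measure E) μ hs
  refine Measure.absolutelyContinuous_isAddHaarMeasure μ (μH[Module.finrank ℝ E] : Measure E) ?_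
  have := hF.hausdorffMeasure_image_le (d := Module.finrank ℝ E) (by positivity) s
  rw [h1, mul_zero] at this
  exact le_antisymm this bot_le

/-- A bi-Lipschitz bijection whose derivative has positive determinant almost everywhere. -/
structure IsOrientedBilipschitz (μ : Measure E) (F : E → E) : Prop where
  bijective : Function.Bijective F
  lipschitz : ∃ C : ℝ≥0, LipschitzWith C F
  antilipschitz : ∃ C : ℝ≥0, AntilipschitzWith C F
  ae_det_pos : ∀ᵐ y ∂μ, DifferentiableAt ℝ F y ∧ 0 < (fderiv ℝ F y).det

omit [FiniteDimensional ℝ E] [BorelSpace E] in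
theorem IsOrientedBilipschitz.id (μ : Measure E) : IsOrientedBilipschitz μ (fun y : E => y) where
  bijective := Function.bijective_id
  lipschitz := ⟨1, LipschitzWith.id⟩
  antilipschitz := ⟨1, AntilipschitzWith.id⟩
  ae_det_pos := Eventually.of_forall fun y => by
    refine ⟨differentiableAt_id, ?_⟩
    rw [show (fun y : E => y) = _root_.id from rfl, fderiv_id]
    have : (ContinuousLinearMap.id ℝ E).det = 1 := LinearMap.det_id
    rw [this]
    exact one_pos

theorem IsOrientedBilipschitz.comp {μ : Measure E} [μ.IsAddHaarMeasure] {F G : E → E}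
    (hG : IsOrientedBilipschitz μ G) (hF : IsOrientedBilipschitz μ F) :
    IsOrientedBilipschitz μ (G ∘ F) := by
  obtain ⟨C, hC⟩ := hF.lipschitz
  obtain ⟨C', hC'⟩ := hG.lipschitz
  obtain ⟨c, hc⟩ := hF.antilipschitz
  obtain ⟨c', hc'⟩ := hG.antilipschitz
  refine ⟨hG.bijective.comp hF.bijective, ⟨_, hC'.comp hC⟩, ⟨_, hc'.comp hc⟩, ?_⟩
  have h1 : ∀ᵐ y ∂μ, DifferentiableAt ℝ G (F y) ∧ 0 < (fderiv ℝ G (F y)).det :=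
    measure_preimage_eq_zero_of_antilipschitz μ hc hG.ae_det_pos
  filter_upwards [h1, hF.ae_det_pos] with y hy1 hy2
  refine ⟨hy1.1.comp y hy2.1, ?_⟩
  rw [fderiv_comp y hy1.1 hy2.1]
  have : ((fderiv ℝ G (F y)).comp (fderiv ℝ F y)).det
      = (fderiv ℝ G (F y)).det * (fderiv ℝ F y).det := LinearMap.det_comp _ _
  rw [this]
  exact mul_pos hy1.2 hy2.2

/-- A contraction added to the identity gives a homeomorphism; Rademacher supplies the derivative,
which lies within distance less than 1 of the identity. -/
theorem IsOrientedBilipschitz.of_norm_sub_le {μ : Measure E} [μ.IsAddHaarMeasure] {G : E → E}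
    {c : ℝ≥0} (hc : c < 1) (h : LipschitzWith c (fun y => G y - y)) :
    IsOrientedBilipschitz μ G := by
  have happ : ApproximatesLinearOn G ((ContinuousLinearEquiv.refl ℝ E : E ≃L[ℝ] E) : E →L[ℝ] E)
      univ c := by
    intro x _ y _
    have := h.norm_sub_le x y
    simp only [ContinuousLinearEquiv.coe_refl, ContinuousLinearMap.coe_id', id_eq]
    rwa [show G x - G y - (x - y) = G x - x - (G y - y) by abel]
  -- Dimension zero is separate: there the identity operator has norm 0, not 1.
  have hcc : Subsingleton E ∨
      c < ‖((ContinuousLinearEquiv.refl ℝ E).symm : E →L[ℝ] E)‖₊⁻¹ := by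
    rcases subsingleton_or_nontrivial E with hE | hE
    · exact Or.inl hE
    · right
      simpa using hc
  have hG : LipschitzWith (c + 1) G := by
    have := h.add LipschitzWith.id
    simpa using this
  have hG' := (AntilipschitzWith.id (α := E)).add_lipschitzWith h (by simpa using hc)
  simp only [id_eq, add_sub_cancel] at hG'
  refine ⟨(happ.toHomeomorph G hcc).bijective, ⟨_, hG⟩, ⟨_, hG'⟩, ?_⟩
  filter_upwards [hG.ae_differentiableAt (μ := μ)] with y hy
  refine ⟨hy, ?_⟩
  have h1 : fderiv ℝ (fun y => G y - y) y = fderiv ℝ G y - 1 := by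
    rw [fderiv_fun_sub hy differentiableAt_fun_id, fderiv_fun_id]; rfl
  have h2 : ‖fderiv ℝ G y - 1‖ < 1 := by
    rw [← h1]
    exact (norm_fderiv_le_of_lipschitz ℝ h).trans_lt (by exact_mod_cast hc)
  simpa using det_one_add_pos h2

end OrientedBilipschitz

/-- Change of variables off a null set N: the factor |det ∇F| cancels the density. The image of N is
null because F is Lipschitz, so the values of the density there are irrelevant and F need not be C¹.
-/
theorem viscousMass_eq_map {d : ℕ} {F : EuclideanSpace ℝ (Fin d) → EuclideanSpace ℝ (Fin d)}
    (hF : IsOrientedBilipschitz volume F) : viscousMass F = Measure.map F volume := by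
  obtain ⟨C, hC⟩ := hF.lipschitz
  have hFm : Measurable F := hC.continuous.measurable
  obtain ⟨N, hsub, hNm, hN0⟩ := exists_measurable_superset_of_null hF.ae_det_pos
  have hD : ∀ y ∈ Nᶜ, DifferentiableAt ℝ F y ∧ 0 < (fderiv ℝ F y).det := by
    intro y hy
    by_contra h
    exact hy (hsub h)
  have himg : F '' Nᶜ =ᵐ[volume] (univ : Set (EuclideanSpace ℝ (Fin d))) := by
    rw [ae_eq_univ, ← image_compl_eq hF.bijective, compl_compl]
    exact measure_image_eq_zero_of_lipschitz volume hC hN0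
  have hNc : (Nᶜ : Set (EuclideanSpace ℝ (Fin d))) =ᵐ[volume] univ := by
    rwa [ae_eq_univ, compl_compl]
  ext s hs
  rw [viscousMass, withDensity_apply _ hs, Measure.map_apply hFm hs,
    ← lintegral_indicator hs, ← setLIntegral_univ, ← setLIntegral_congr himg,
    lintegral_image_eq_lintegral_abs_det_fderiv_mul volume hNm.compl
      (fun y hy => (hD y hy).1.hasFDerivAt.hasFDerivWithinAt) hF.bijective.1.injOn,
    setLIntegral_congr_fun (g := (F ⁻¹' s).indicator 1) hNm.compl, setLIntegral_congr hNc,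
    setLIntegral_univ, lintegral_indicator_one (hFm hs)]
  intro y hy
  have hdet := (hD y hy).2
  by_cases hys : F y ∈ s
  · have hys' : y ∈ F ⁻¹' s := hys
    simp only [indicator_of_mem hys, indicator_of_mem hys', transportedDensity,
      Function.leftInverse_invFun hF.bijective.1 y, Pi.one_apply]
    rw [← ENNReal.ofReal_mul (abs_nonneg _), abs_of_pos hdet, mul_inv_cancel₀ hdet.ne',
      ENNReal.ofReal_one]
  · have hys' : y ∉ F ⁻¹' s := hys
    simp [indicator_of_notMem hys, indicator_of_notMem hys']

/-! ### Gronwall estimates, existence of trajectories, and regularity of the flow map. -/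

section Trajectories

/-- The function exp(-c(s - a)) q(s) - m s is nonincreasing. Derivatives are asked for only in the
open interval, since the curves need not be differentiable at time 0. -/
theorem le_exp_mul_of_deriv_le {q q' : ℝ → ℝ} {a b c m : ℝ} (hab : a ≤ b) (hc : 0 ≤ c)
    (hm : 0 ≤ m) (hq : ContinuousOn q (Icc a b)) (hd : ∀ s ∈ Ioo a b, HasDerivAt q (q' s) s)
    (hle : ∀ s ∈ Ioo a b, q' s ≤ c * q s + m) :
    q b ≤ Real.exp (c * (b - a)) * (q a + m * (b - a)) := by
  have hder : ∀ s ∈ Ioo a b, HasDerivAt (fun s => Real.exp (-c * (s - a)) * q s - m * s)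
      (Real.exp (-c * (s - a)) * (-c) * q s + Real.exp (-c * (s - a)) * q' s - m) s := by
    intro s hs
    have h1 : HasDerivAt (fun s : ℝ => -c * (s - a)) (-c) s := by
      simpa using ((hasDerivAt_id s).sub_const a).const_mul (-c)
    have h2 : HasDerivAt (fun s : ℝ => m * s) m s := by
      simpa using (hasDerivAt_id s).const_mul m
    exact (h1.exp.mul (hd s hs)).sub h2
  have hanti : AntitoneOn (fun s => Real.exp (-c * (s - a)) * q s - m * s) (Icc a b) := by
    refine antitoneOn_of_deriv_nonpos (convex_Icc a b) (by fun_prop) ?_ ?_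
    · rw [interior_Icc]
      exact fun s hs => (hder s hs).differentiableAt.differentiableWithinAt
    · rw [interior_Icc]
      intro s hs
      rw [(hder s hs).deriv]
      have h1 : Real.exp (-c * (s - a)) ≤ 1 := by
        rw [Real.exp_le_one_iff]
        nlinarith [hs.1]
      have h2 := hle s hs
      have h3 := Real.exp_pos (-c * (s - a))
      nlinarith
  have := hanti (left_mem_Icc.2 hab) (right_mem_Icc.2 hab) hab
  simp only [sub_self, mul_zero, Real.exp_zero, one_mul] at this
  have h4 : Real.exp (-c * (b - a)) * q b ≤ q a + m * (b - a) := by linarith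
  calc q b = Real.exp (c * (b - a)) * (Real.exp (-c * (b - a)) * q b) := by
        rw [← mul_assoc, ← Real.exp_add]; simp
    _ ≤ _ := by gcongr

variable {E : Type*} [NormedAddCommGroup E] [InnerProductSpace ℝ E]

theorem norm_sub_le_of_hasDerivAt_Ioo {D D' : ℝ → E} {a b C : ℝ} (hab : a ≤ b)
    (hD : ContinuousOn D (Icc a b)) (hd : ∀ s ∈ Ioo a b, HasDerivAt D (D' s) s)
    (hle : ∀ s ∈ Ioo a b, ‖D' s‖ ≤ C) : ‖D b - D a‖ ≤ C * (b - a) := by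
  rcases hab.eq_or_lt with rfl | hlt
  · simp
  have hC : 0 ≤ C := (norm_nonneg _).trans (hle ((a + b) / 2) ⟨by linarith, by linarith⟩)
  -- Pairing with the total increment reduces the vector-valued bound to the scalar one.
  set e := D b - D a with he
  have := le_exp_mul_of_deriv_le (q := fun s => inner ℝ (D s) e)
    (q' := fun s => inner ℝ (D' s) e) (c := 0) (m := C * ‖e‖) hab le_rfl (by positivity)
    (hD.inner continuousOn_const)
    (fun s hs => by simpa using (hd s hs).inner ℝ (hasDerivAt_const s e))
    (fun s hs => by
      rw [zero_mul, zero_add]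
      exact (real_inner_le_norm _ _).trans (by gcongr; exact hle s hs))
  simp only [zero_mul, Real.exp_zero, one_mul] at this
  have h2 : ‖e‖ * ‖e‖ ≤ C * ‖e‖ * (b - a) := by
    rw [← real_inner_self_eq_norm_mul_norm]
    nth_rw 1 [he]
    rw [inner_sub_left]
    linarith
  by_cases h0 : ‖e‖ = 0
  · rw [h0]; exact mul_nonneg hC (by linarith)
  · have : 0 < ‖e‖ := lt_of_le_of_ne (norm_nonneg _) (Ne.symm h0)
    refine le_of_mul_le_mul_right ?_ this
    linarith

/-- A curve on `[0, ∞)` that is continuous and solves `z' = w(s, z)` for `s > 0`. -/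
structure IsTrajectory (w : ℝ → E → E) (z : ℝ → E) : Prop where
  continuousOn : ContinuousOn z (Ici 0)
  hasDerivAt : ∀ s, 0 < s → HasDerivAt z (w s (z s)) s

variable {w : ℝ → E → E} {z z' : ℝ → E}

theorem IsTrajectory.norm_sub_le {L : ℝ≥0} {a b : ℝ} (hz : IsTrajectory w z)
    (hz' : IsTrajectory w z') (ha : 0 ≤ a) (hab : a ≤ b)
    (hL : ∀ s ∈ Icc 0 b, LipschitzWith L (w s)) :
    ‖z b - z' b‖ ≤ Real.exp (L * (b - a)) * ‖z a - z' a‖ := by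
  have hsub : Icc a b ⊆ Ici 0 := fun s hs => ha.trans hs.1
  have hder : ∀ s ∈ Ioo a b, HasDerivAt (fun s => ‖z s - z' s‖ ^ 2)
      (2 * inner ℝ (z s - z' s) (w s (z s) - w s (z' s))) s := fun s hs =>
    ((hz.hasDerivAt s (ha.trans_lt hs.1)).sub (hz'.hasDerivAt s (ha.trans_lt hs.1))).norm_sq
  have := le_exp_mul_of_deriv_le (c := 2 * L) (m := 0) hab (by positivity) le_rfl
    (((hz.continuousOn.mono hsub).sub (hz'.continuousOn.mono hsub)).norm.pow 2) hder
    (fun s hs => by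
      have h1 := real_inner_le_norm (z s - z' s) (w s (z s) - w s (z' s))
      have h2 := (hL s ⟨ha.trans hs.1.le, hs.2.le⟩).norm_sub_le (z s) (z' s)
      have h3 : ‖z s - z' s‖ * ‖w s (z s) - w s (z' s)‖ ≤
        ‖z s - z' s‖ * (L * ‖z s - z' s‖) := by gcongr
      simp only [Pi.pow_apply, Pi.sub_apply]
      nlinarith)
  simp only [zero_mul, add_zero, Pi.pow_apply, Pi.sub_apply] at this
  refine le_of_sq_le_sq ?_ (by positivity)
  calc ‖z b - z' b‖ ^ 2 ≤ _ := this
    _ = (Real.exp (L * (b - a)) * ‖z a - z' a‖) ^ 2 := by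
      rw [mul_pow, ← Real.exp_nat_mul]; ring_nf

/-- Measures how far the transition map from time a to time b is from the identity in Lipschitz
norm; this is small for short steps. -/
theorem IsTrajectory.norm_sub_sub_le {L : ℝ≥0} {a b : ℝ} (hz : IsTrajectory w z)
    (hz' : IsTrajectory w z') (ha : 0 ≤ a) (hab : a ≤ b)
    (hL : ∀ s ∈ Icc 0 b, LipschitzWith L (w s)) :
    ‖(z b - z' b) - (z a - z' a)‖ ≤
      (L * (b - a) * Real.exp (L * (b - a))) * ‖z a - z' a‖ := by
  have hsub : Icc a b ⊆ Ici 0 := fun s hs => ha.trans hs.1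
  have := norm_sub_le_of_hasDerivAt_Ioo (D := fun s => z s - z' s)
    (C := L * (Real.exp (L * (b - a)) * ‖z a - z' a‖)) hab
    ((hz.continuousOn.mono hsub).sub (hz'.continuousOn.mono hsub))
    (fun s hs => (hz.hasDerivAt s (ha.trans_lt hs.1)).sub (hz'.hasDerivAt s (ha.trans_lt hs.1)))
    (fun s hs => by
      refine ((hL s ⟨ha.trans hs.1.le, hs.2.le⟩).norm_sub_le (z s) (z' s)).trans ?_
      gcongr
      refine (hz.norm_sub_le hz' ha hs.1.le
        (fun r hr => hL r ⟨hr.1, hr.2.trans hs.2.le⟩)).trans ?_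
      gcongr
      exact hs.2.le)
  linarith

variable [FiniteDimensional ℝ E]

theorem exists_isTrajectory
    (hL : ∀ S : ℝ, ∃ L : ℝ≥0, ∀ s ∈ Icc 0 S, LipschitzWith L (w s))
    (hcont : ∀ x, ContinuousOn (fun s => w s x) (Ici 0))
    (hbdd : ∀ S : ℝ, ∃ B : ℝ≥0, ∀ s ∈ Icc 0 S, ∀ x, ‖w s x‖ ≤ B) (x : E) :
    ∃ z, IsTrajectory w z ∧ z 0 = x := by
  have hloc : ∀ n : ℕ, ∃ z : ℝ → E, z 0 = x ∧
      ∀ s ∈ Icc (0 : ℝ) (n + 1), HasDerivWithinAt z (w s (z s)) (Icc 0 ((n : ℝ) + 1)) s := by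
    intro n
    obtain ⟨L, hL⟩ := hL (n + 1)
    obtain ⟨B, hB⟩ := hbdd (n + 1)
    have h0 : (0 : ℝ) ∈ Icc (0 : ℝ) (n + 1) := ⟨le_rfl, by positivity⟩
    -- The field is bounded on all of space, so a ball of radius B(n + 1) cannot be left before time
    -- n + 1.
    have : IsPicardLindelof w (⟨0, h0⟩ : Icc (0 : ℝ) (n + 1)) x (B * (n + 1)) 0 B L :=
      { lipschitzOnWith := fun s hs => (hL s hs).lipschitzOnWith
        continuousOn := fun x _ => (hcont x).mono fun s hs => hs.1
        norm_le := fun s hs x _ => hB s hs x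
        mul_max_le := by
          have : max ((n : ℝ) + 1) 0 = n + 1 := max_eq_left (by positivity)
          simp [this] }
    exact this.exists_eq_forall_mem_Icc_hasDerivWithinAt₀
  choose Z hZ0 hZ using hloc
  have hZat : ∀ n : ℕ, ∀ s ∈ Ioo (0 : ℝ) (n + 1), HasDerivAt (Z n) (w s (Z n s)) s :=
    fun n s hs => (hZ n s ⟨hs.1.le, hs.2.le⟩).hasDerivAt (Icc_mem_nhds hs.1 hs.2)
  have hZc : ∀ n : ℕ, ContinuousOn (Z n) (Icc 0 ((n : ℝ) + 1)) :=
    fun n s hs => (hZ n s hs).continuousWithinAt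
  have hagree : ∀ m n : ℕ, m ≤ n → EqOn (Z m) (Z n) (Icc 0 ((m : ℝ) + 1)) := by
    intro m n hmn s hs
    have hmn' : (m : ℝ) ≤ n := by exact_mod_cast hmn
    obtain ⟨L, hL⟩ := hL s
    have := le_exp_mul_of_deriv_le (q := fun s => ‖Z m s - Z n s‖ ^ 2)
      (q' := fun s => 2 * inner ℝ (Z m s - Z n s) (w s (Z m s) - w s (Z n s)))
      (c := 2 * L) (m := 0) hs.1 (by positivity) le_rfl
      (((((hZc m).mono (Icc_subset_Icc_right hs.2)).sub
        ((hZc n).mono (Icc_subset_Icc_right (by linarith [hs.2])))).norm).pow 2)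
      (fun r hr => ((hZat m r ⟨hr.1, hr.2.trans_le hs.2⟩).sub
        (hZat n r ⟨hr.1, by linarith [hr.2, hs.2]⟩)).norm_sq)
      (fun r hr => by
        have h1 := real_inner_le_norm (Z m r - Z n r) (w r (Z m r) - w r (Z n r))
        have h2 := (hL r ⟨hr.1.le, hr.2.le⟩).norm_sub_le (Z m r) (Z n r)
        have h3 : ‖Z m r - Z n r‖ * ‖w r (Z m r) - w r (Z n r)‖ ≤
          ‖Z m r - Z n r‖ * (L * ‖Z m r - Z n r‖) := by gcongr
        nlinarith)
    simp only [hZ0, sub_self, norm_zero] at this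
    have h0 : ‖Z m s - Z n s‖ ^ 2 ≤ 0 := by simpa using this
    exact sub_eq_zero.1 (norm_eq_zero.1 (by nlinarith [norm_nonneg (Z m s - Z n s)]))
  have hev : ∀ n : ℕ, ∀ r ∈ Icc (0 : ℝ) (n + 1), Z ⌊r⌋₊ r = Z n r := by
    intro n r hr
    have h1 : r ∈ Icc (0 : ℝ) (⌊r⌋₊ + 1) := ⟨hr.1, (Nat.lt_floor_add_one r).le⟩
    rcases le_total ⌊r⌋₊ n with h | h
    · exact hagree _ _ h h1
    · exact (hagree _ _ h hr).symm
  -- The solution of index ⌊s⌋₊ lives up to ⌊s⌋₊ + 1 > s, which leaves room to the right of s for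
  -- the derivative.
  refine ⟨fun s => Z ⌊s⌋₊ s, ⟨?_, ?_⟩, by simp [hZ0]⟩
  · intro s hs
    have hlt : s < ⌊s⌋₊ + 1 := Nat.lt_floor_add_one s
    have h1 : ContinuousWithinAt (Z ⌊s⌋₊) (Ici 0) s :=
      ((hZc ⌊s⌋₊) s ⟨hs, hlt.le⟩).mono_of_mem_nhdsWithin
        (mem_nhdsWithin.2 ⟨Iio (⌊s⌋₊ + 1), isOpen_Iio, hlt, fun r hr => ⟨hr.2, hr.1.le⟩⟩)
    refine h1.congr_of_eventuallyEq ?_ rfl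
    filter_upwards [self_mem_nhdsWithin, mem_nhdsWithin_of_mem_nhds (Iio_mem_nhds hlt)]
      with r hr hr'
    exact hev _ r ⟨hr, le_of_lt hr'⟩
  · intro s hs
    have hlt : s < ⌊s⌋₊ + 1 := Nat.lt_floor_add_one s
    refine (hZat ⌊s⌋₊ s ⟨hs, hlt⟩).congr_of_eventuallyEq ?_
    filter_upwards [Ioo_mem_nhds hs hlt] with r hr
    exact hev _ r ⟨hr.1.le, hr.2.le⟩

variable [MeasurableSpace E] [BorelSpace E]

theorem isOrientedBilipschitz_of_isTrajectory {μ : Measure E} [μ.IsAddHaarMeasure]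
    {Z : E → ℝ → E} (hZ : ∀ y, IsTrajectory w (Z y)) (hZ0 : ∀ y, Z y 0 = y)
    (hL : ∀ S : ℝ, ∃ L : ℝ≥0, ∀ s ∈ Icc 0 S, LipschitzWith L (w s)) {s : ℝ} (hs : 0 ≤ s) :
    IsOrientedBilipschitz μ (fun y => Z y s) := by
  obtain ⟨L, hL⟩ := hL s
  -- With L(b - a) ≤ 1/4 the exponential is at most 2, so the transition map differs from the
  -- identity by a 1/2-Lipschitz map.
  have hstep : ∀ a b, 0 ≤ a → a ≤ b → b ≤ s → L * (b - a) ≤ 1 / 4 →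
      IsOrientedBilipschitz μ (fun y => Z y a) → IsOrientedBilipschitz μ (fun y => Z y b) := by
    intro a b ha hab hbs hsmall hFa
    obtain ⟨g, hg1, hg2⟩ := Function.bijective_iff_has_inverse.1 hFa.bijective
    have hexp : Real.exp (L * (b - a)) ≤ 2 := by
      have h1 : L * (b - a) ≤ Real.log 2 := by linarith [Real.log_two_gt_d9]
      exact (Real.exp_le_exp.2 h1).trans_eq (Real.exp_log two_pos)
    have hlip : LipschitzWith (1 / 2) (fun x => Z (g x) b - x) := by
      refine LipschitzWith.of_dist_le_mul fun x x' => ?_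
      have h1 := (hZ (g x)).norm_sub_sub_le (hZ (g x')) ha hab
        (fun r hr => hL r ⟨hr.1, hr.2.trans hbs⟩)
      have hx : ∀ x, Z (g x) a = x := hg2
      rw [hx x, hx x'] at h1
      rw [dist_eq_norm, dist_eq_norm,
        show Z (g x) b - x - (Z (g x') b - x') = Z (g x) b - Z (g x') b - (x - x') by abel]
      refine h1.trans ?_
      gcongr
      have h0 : 0 ≤ L * (b - a) := mul_nonneg L.2 (by linarith)
      push_cast
      nlinarith
    have hG : IsOrientedBilipschitz μ (fun x => Z (g x) b) :=
      IsOrientedBilipschitz.of_norm_sub_le (by norm_num) hlip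
    have := hG.comp hFa
    convert! this using 2 with y
    exact congrArg (fun y => Z y b) (hg1 y).symm
  obtain ⟨n, hn⟩ := exists_nat_gt (4 * (L * s))
  have hn0 : (0 : ℝ) < n := lt_of_le_of_lt (by positivity) hn
  have hind : ∀ k : ℕ, k ≤ n → IsOrientedBilipschitz μ (fun y => Z y (k * (s / n))) := by
    intro k
    induction k with
    | zero =>
      intro _
      simpa [hZ0] using IsOrientedBilipschitz.id μ
    | succ k ih =>
      intro hk
      have hk' : ((k : ℝ) + 1) ≤ n := by exact_mod_cast hk
      have hsn : 0 ≤ s / n := by positivity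
      refine hstep _ _ (by positivity) (by push_cast; nlinarith) ?_ ?_ (ih (by omega))
      · push_cast
        calc ((k : ℝ) + 1) * (s / n) ≤ n * (s / n) := by gcongr
          _ = s := by field_simp
      · push_cast
        rw [show (L : ℝ) * (((k : ℝ) + 1) * (s / n) - k * (s / n)) = (4 * (L * s)) / n / 4 by
          field_simp; ring]
        have : (4 * (L * s)) / n ≤ 1 := by rw [div_le_one hn0]; exact hn.le
        linarith
  have := hind n le_rfl
  rwa [show (n : ℝ) * (s / n) = s by field_simp] at this

end Trajectories

/-! ### Exponential inequalities and pointwise bounds for the Gaussian weight. -/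

/-- This is Hölder's inequality: subtracting A and B makes both exponentials integrate to one, after
which convexity of exp is applied pointwise. -/
theorem convexOn_log_integral_exp {E Ω : Type*} [AddCommGroup E] [Module ℝ E]
    [MeasurableSpace Ω] {μ : Measure Ω} {c : E → Ω → ℝ}
    (hc : ∀ ω, ConvexOn ℝ univ (fun x => c x ω))
    (hint : ∀ x, Integrable (fun ω => Real.exp (c x ω)) μ)
    (hpos : ∀ x, 0 < ∫ ω, Real.exp (c x ω) ∂μ) :
    ConvexOn ℝ univ (fun x => Real.log (∫ ω, Real.exp (c x ω) ∂μ)) := by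
  refine ⟨convex_univ, fun a _ b _ p q hp hq hpq => ?_⟩
  set A := Real.log (∫ ω, Real.exp (c a ω) ∂μ) with hA
  set B := Real.log (∫ ω, Real.exp (c b ω) ∂μ) with hB
  have hexpA : Real.exp A = ∫ ω, Real.exp (c a ω) ∂μ := Real.exp_log (hpos a)
  have hexpB : Real.exp B = ∫ ω, Real.exp (c b ω) ∂μ := Real.exp_log (hpos b)
  simp only [smul_eq_mul]
  have hpt : ∀ ω, Real.exp (c (p • a + q • b) ω) ≤ Real.exp (p * A + q * B) *
      (p * (Real.exp (-A) * Real.exp (c a ω)) + q * (Real.exp (-B) * Real.exp (c b ω))) := by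
    intro ω
    have h1 := (hc ω).2 (mem_univ a) (mem_univ b) hp hq hpq
    have h2 := convexOn_exp.2 (mem_univ (-A + c a ω)) (mem_univ (-B + c b ω)) hp hq hpq
    simp only [smul_eq_mul] at h1 h2
    rw [← Real.exp_add, ← Real.exp_add]
    calc Real.exp (c (p • a + q • b) ω)
        ≤ Real.exp ((p * A + q * B) + (p * (-A + c a ω) + q * (-B + c b ω))) := by
          apply Real.exp_le_exp.2; linarith
      _ ≤ _ := by rw [Real.exp_add]; gcongr
  have hia := ((hint a).const_mul (Real.exp (-A))).const_mul p
  have hib := ((hint b).const_mul (Real.exp (-B))).const_mul q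
  have := integral_mono (hint _) ((hia.add hib).const_mul (Real.exp (p * A + q * B))) hpt
  rw [integral_const_mul, integral_add' hia hib, integral_const_mul, integral_const_mul,
    integral_const_mul, integral_const_mul, ← hexpA, ← hexpB, ← Real.exp_add, ← Real.exp_add,
    neg_add_cancel, neg_add_cancel, Real.exp_zero, mul_one, mul_one, hpq, mul_one] at this
  exact (Real.log_le_iff_le_exp (hpos _)).2 this

/-- The error is kept relative to exp b, so that after integration it becomes a multiple of the
Gaussian mass at the base point. -/
theorem abs_exp_sub_exp_le {a b r : ℝ} (h : |a - b| ≤ r) :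
    |Real.exp a - Real.exp b| ≤ r * Real.exp r * Real.exp b := by
  have hr : 0 ≤ r := (abs_nonneg _).trans h
  have h1 := Real.add_one_le_exp (a - b)
  have h2 := Real.add_one_le_exp (b - a)
  have hb := Real.exp_pos b
  have hab : Real.exp a = Real.exp (a - b) * Real.exp b := by rw [← Real.exp_add]; simp
  have hba : Real.exp (b - a) * Real.exp (a - b) = 1 := by rw [← Real.exp_add]; simp
  have h3 : Real.exp (a - b) ≤ Real.exp r := Real.exp_le_exp.2 ((le_abs_self _).trans h)
  have h4 : 1 ≤ Real.exp r := Real.one_le_exp hr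
  have hu := Real.exp_pos (a - b)
  obtain ⟨h5, h6⟩ := abs_le.1 h
  rw [hab, show Real.exp (a - b) * Real.exp b - Real.exp b
    = (Real.exp (a - b) - 1) * Real.exp b by ring, abs_mul, abs_of_pos hb]
  refine mul_le_mul_of_nonneg_right ?_ hb.le
  rw [abs_le]
  constructor
  · nlinarith
  · have : Real.exp (a - b) - 1 ≤ (a - b) * Real.exp (a - b) := by nlinarith
    nlinarith

section GaussianWeight

variable {V : Type*} [NormedAddCommGroup V] [InnerProductSpace ℝ V] {ψ : V → ℝ} {k : ℝ≥0}

theorem abs_sub_le_of_lipschitz (hψ : LipschitzWith k ψ) (σ : ℝ) (x w : V) :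
    |ψ (x + σ • w) - ψ x| ≤ k * |σ| * ‖w‖ := by
  have := hψ.norm_sub_le (x + σ • w) x
  rw [add_sub_cancel_left, norm_smul, Real.norm_eq_abs, Real.norm_eq_abs] at this
  linarith

theorem gauss_exp_le (hψ : LipschitzWith k ψ) {σ S : ℝ} (hσ : |σ| ≤ S) (x w : V) :
    Real.exp (-(1 / 2) * ‖w‖ ^ 2 + ψ (x + σ • w)) ≤
      Real.exp (ψ x) * Real.exp (-(1 / 2) * ‖w‖ ^ 2 + k * S * ‖w‖) := by
  rw [← Real.exp_add, Real.exp_le_exp]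
  have h1 := (abs_le.1 (abs_sub_le_of_lipschitz hψ σ x w)).2
  have h2 : k * |σ| * ‖w‖ ≤ k * S * ‖w‖ := by gcongr
  linarith

theorem le_gauss_exp (hψ : LipschitzWith k ψ) {σ S : ℝ} (hσ : |σ| ≤ S) (x w : V) :
    Real.exp (ψ x) * Real.exp (-(1 / 2) * ‖w‖ ^ 2 + -(k * S) * ‖w‖) ≤
      Real.exp (-(1 / 2) * ‖w‖ ^ 2 + ψ (x + σ • w)) := by
  rw [← Real.exp_add, Real.exp_le_exp]
  have h1 := (abs_le.1 (abs_sub_le_of_lipschitz hψ σ x w)).1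
  have h2 : k * |σ| * ‖w‖ ≤ k * S * ‖w‖ := by gcongr
  linarith

theorem abs_gauss_exp_sub_le (hψ : LipschitzWith k ψ) (σ : ℝ) (x x' w : V) :
    |Real.exp (-(1 / 2) * ‖w‖ ^ 2 + ψ (x + σ • w)) -
      Real.exp (-(1 / 2) * ‖w‖ ^ 2 + ψ (x' + σ • w))| ≤
      k * ‖x - x'‖ * Real.exp (k * ‖x - x'‖) *
        Real.exp (-(1 / 2) * ‖w‖ ^ 2 + ψ (x' + σ • w)) := by
  apply abs_exp_sub_exp_le
  have := hψ.norm_sub_le (x + σ • w) (x' + σ • w)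
  rw [add_sub_add_right_eq_sub, Real.norm_eq_abs] at this
  rwa [add_sub_add_left_eq_sub]

end GaussianWeight

/-! ### Gaussian mass, moment and mean: regularity, convexity, differentiation. -/

section GaussianTransform

variable {V : Type*} [NormedAddCommGroup V] [InnerProductSpace ℝ V] [FiniteDimensional ℝ V]
  [MeasurableSpace V] [BorelSpace V]

theorem integrable_exp_neg_mul_sq_norm {b : ℝ} (hb : 0 < b) :
    Integrable (fun w : V => Real.exp (-b * ‖w‖ ^ 2)) := by
  have := (GaussianFourier.integrable_cexp_neg_mul_sq_norm_add (V := V) (b := b)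
    (by simpa using hb) 0 0).norm
  refine this.congr (Eventually.of_forall fun w => ?_)
  simp only [Complex.norm_exp]
  congr 1
  simp [← Complex.ofReal_pow, ← Complex.ofReal_neg, ← Complex.ofReal_mul]

theorem integrable_exp_neg_mul_sq_norm_add {b : ℝ} (hb : 0 < b) (c : ℝ) :
    Integrable (fun w : V => Real.exp (-b * ‖w‖ ^ 2 + c * ‖w‖)) := by
  refine ((integrable_exp_neg_mul_sq_norm (V := V) (half_pos hb)).const_mul
    (Real.exp (c ^ 2 / (2 * b)))).mono' (by fun_prop) (Eventually.of_forall fun w => ?_)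
  rw [Real.norm_eq_abs, Real.abs_exp, ← Real.exp_add, Real.exp_le_exp]
  have h : c ^ 2 / (2 * b) + -(b / 2) * ‖w‖ ^ 2 - (-b * ‖w‖ ^ 2 + c * ‖w‖)
      = (b * ‖w‖ - c) ^ 2 / (2 * b) := by field_simp; ring
  have : 0 ≤ (b * ‖w‖ - c) ^ 2 / (2 * b) := by positivity
  linarith

theorem integrable_norm_mul_exp_neg_mul_sq_norm_add {b : ℝ} (hb : 0 < b) (c : ℝ) :
    Integrable (fun w : V => ‖w‖ * Real.exp (-b * ‖w‖ ^ 2 + c * ‖w‖)) := by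
  refine (integrable_exp_neg_mul_sq_norm_add (V := V) hb (c + 1)).mono' (by fun_prop)
    (Eventually.of_forall fun w => ?_)
  rw [Real.norm_eq_abs, abs_of_nonneg (by positivity)]
  calc ‖w‖ * Real.exp (-b * ‖w‖ ^ 2 + c * ‖w‖)
      ≤ Real.exp ‖w‖ * Real.exp (-b * ‖w‖ ^ 2 + c * ‖w‖) := by
        gcongr; linarith [Real.add_one_le_exp ‖w‖]
    _ = _ := by rw [← Real.exp_add]; ring_nf

/-- The unnormalised Gaussian average of `exp ∘ ψ` at scale `σ`. -/
noncomputable def gaussMass (ψ : V → ℝ) (σ : ℝ) (x : V) : ℝ :=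
  ∫ w, Real.exp (-(1 / 2) * ‖w‖ ^ 2 + ψ (x + σ • w))

/-- The first moment corresponding to `gaussMass`. -/
noncomputable def gaussMoment (ψ : V → ℝ) (σ : ℝ) (x : V) : V :=
  ∫ w, Real.exp (-(1 / 2) * ‖w‖ ^ 2 + ψ (x + σ • w)) • w

/-- The mean displacement `gaussMoment / gaussMass`. -/
noncomputable def gaussMean (ψ : V → ℝ) (σ : ℝ) (x : V) : V :=
  (gaussMass ψ σ x)⁻¹ • gaussMoment ψ σ x

variable {ψ : V → ℝ} {k : ℝ≥0}

theorem integrable_gauss_exp (hψ : LipschitzWith k ψ) (σ : ℝ) (x : V) :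
    Integrable (fun w => Real.exp (-(1 / 2) * ‖w‖ ^ 2 + ψ (x + σ • w))) := by
  have hc := hψ.continuous
  refine ((integrable_exp_neg_mul_sq_norm_add (V := V) one_half_pos (k * |σ|)).const_mul
    (Real.exp (ψ x))).mono' (by fun_prop) (Eventually.of_forall fun w => ?_)
  rw [Real.norm_eq_abs, Real.abs_exp]
  exact gauss_exp_le hψ le_rfl x w

theorem integrable_norm_mul_gauss_exp (hψ : LipschitzWith k ψ) (σ : ℝ) (x : V) :
    Integrable (fun w => ‖w‖ * Real.exp (-(1 / 2) * ‖w‖ ^ 2 + ψ (x + σ • w))) := by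
  have hc := hψ.continuous
  refine ((integrable_norm_mul_exp_neg_mul_sq_norm_add (V := V) one_half_pos
    (k * |σ|)).const_mul (Real.exp (ψ x))).mono' (by fun_prop)
    (Eventually.of_forall fun w => ?_)
  rw [Real.norm_eq_abs, abs_of_nonneg (by positivity), mul_left_comm]
  gcongr
  exact gauss_exp_le hψ le_rfl x w

theorem integrable_gauss_exp_smul (hψ : LipschitzWith k ψ) (σ : ℝ) (x : V) :
    Integrable (fun w => Real.exp (-(1 / 2) * ‖w‖ ^ 2 + ψ (x + σ • w)) • w) := by
  have hc := hψ.continuous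
  refine (integrable_norm_mul_gauss_exp hψ σ x).mono' (by fun_prop)
    (Eventually.of_forall fun w => ?_)
  rw [norm_smul, Real.norm_eq_abs, Real.abs_exp, mul_comm]

theorem gaussMass_pos (hψ : LipschitzWith k ψ) (σ : ℝ) (x : V) : 0 < gaussMass ψ σ x :=
  integral_exp_pos (integrable_gauss_exp hψ σ x)

/-- Both sides are comparable to exp(ψ x), which cancels; hence the constant depends on neither x
nor σ in [-S, S]. -/
theorem exists_integral_norm_mul_le (hψ : LipschitzWith k ψ) (S : ℝ) :
    ∃ M : ℝ≥0, ∀ σ : ℝ, |σ| ≤ S → ∀ x,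
      ∫ w, ‖w‖ * Real.exp (-(1 / 2) * ‖w‖ ^ 2 + ψ (x + σ • w)) ≤ M * gaussMass ψ σ x := by
  set m0 := ∫ w : V, Real.exp (-(1 / 2) * ‖w‖ ^ 2 + -(k * S) * ‖w‖) with hm0
  set m1 := ∫ w : V, ‖w‖ * Real.exp (-(1 / 2) * ‖w‖ ^ 2 + k * S * ‖w‖) with hm1
  have h0i := integrable_exp_neg_mul_sq_norm_add (V := V) one_half_pos (-(k * S))
  have h1i := integrable_norm_mul_exp_neg_mul_sq_norm_add (V := V) one_half_pos (k * S)
  have hm0p : 0 < m0 := integral_exp_pos h0i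
  have hm1p : 0 ≤ m1 := integral_nonneg fun w => by positivity
  refine ⟨(m1 / m0).toNNReal, fun σ hσ x => ?_⟩
  have hJ : ∫ w, ‖w‖ * Real.exp (-(1 / 2) * ‖w‖ ^ 2 + ψ (x + σ • w)) ≤ Real.exp (ψ x) * m1 := by
    rw [hm1, ← integral_const_mul]
    refine integral_mono (integrable_norm_mul_gauss_exp hψ σ x) (h1i.const_mul _) fun w => ?_
    simp only
    rw [mul_left_comm]
    gcongr
    exact gauss_exp_le hψ hσ x w
  have hH : Real.exp (ψ x) * m0 ≤ gaussMass ψ σ x := by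
    rw [hm0, ← integral_const_mul]
    exact integral_mono (h0i.const_mul _) (integrable_gauss_exp hψ σ x)
      fun w => le_gauss_exp hψ hσ x w
  refine hJ.trans ?_
  calc Real.exp (ψ x) * m1 = m1 / m0 * (Real.exp (ψ x) * m0) := by field_simp
    _ ≤ _ := by
      rw [Real.coe_toNNReal _ (by positivity)]
      gcongr

theorem norm_gaussMoment_le (ψ : V → ℝ) (σ : ℝ) (x : V) : ‖gaussMoment ψ σ x‖ ≤
    ∫ w, ‖w‖ * Real.exp (-(1 / 2) * ‖w‖ ^ 2 + ψ (x + σ • w)) := by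
  refine (norm_integral_le_integral_norm _).trans_eq (integral_congr_ae
    (Eventually.of_forall fun w => ?_))
  simp only [norm_smul, Real.norm_eq_abs, Real.abs_exp, mul_comm]

theorem exists_norm_gaussMean_le (hψ : LipschitzWith k ψ) (S : ℝ) :
    ∃ M : ℝ≥0, ∀ σ : ℝ, |σ| ≤ S → ∀ x, ‖gaussMean ψ σ x‖ ≤ M := by
  obtain ⟨M, hM⟩ := exists_integral_norm_mul_le hψ S
  refine ⟨M, fun σ hσ x => ?_⟩
  have hH := gaussMass_pos hψ σ x
  rw [gaussMean, norm_smul, norm_inv, Real.norm_of_nonneg hH.le, inv_mul_le_iff₀ hH, mul_comm]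
  exact (norm_gaussMoment_le ψ σ x).trans (hM σ hσ x)

theorem abs_gaussMass_sub_le (hψ : LipschitzWith k ψ) (σ : ℝ) (x x' : V) :
    |gaussMass ψ σ x - gaussMass ψ σ x'| ≤
      k * ‖x - x'‖ * Real.exp (k * ‖x - x'‖) * gaussMass ψ σ x' := by
  rw [gaussMass, gaussMass, ← integral_sub (integrable_gauss_exp hψ σ x)
    (integrable_gauss_exp hψ σ x'), ← integral_const_mul, ← Real.norm_eq_abs]
  refine norm_integral_le_of_norm_le ((integrable_gauss_exp hψ σ x').const_mul _)
    (Eventually.of_forall fun w => abs_gauss_exp_sub_le hψ σ x x' w)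

theorem norm_gaussMoment_sub_le (hψ : LipschitzWith k ψ) (σ : ℝ) (x x' : V) :
    ‖gaussMoment ψ σ x - gaussMoment ψ σ x'‖ ≤ k * ‖x - x'‖ * Real.exp (k * ‖x - x'‖) *
      ∫ w, ‖w‖ * Real.exp (-(1 / 2) * ‖w‖ ^ 2 + ψ (x' + σ • w)) := by
  rw [gaussMoment, gaussMoment, ← integral_sub (integrable_gauss_exp_smul hψ σ x)
    (integrable_gauss_exp_smul hψ σ x'), ← integral_const_mul]
  refine norm_integral_le_of_norm_le ((integrable_norm_mul_gauss_exp hψ σ x').const_mul _)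
    (Eventually.of_forall fun w => ?_)
  rw [← sub_smul, norm_smul, Real.norm_eq_abs, mul_comm, mul_left_comm]
  gcongr
  exact abs_gauss_exp_sub_le hψ σ x x' w

theorem exists_lipschitzWith_gaussMean (hψ : LipschitzWith k ψ) (S : ℝ) :
    ∃ L : ℝ≥0, ∀ σ : ℝ, |σ| ≤ S → LipschitzWith L (gaussMean ψ σ) := by
  obtain ⟨M, hM⟩ := exists_integral_norm_mul_le hψ S
  have hbound : ∀ σ : ℝ, |σ| ≤ S → ∀ x, ‖gaussMoment ψ σ x‖ ≤ M * gaussMass ψ σ x :=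
    fun σ hσ x => (norm_gaussMoment_le ψ σ x).trans (hM σ hσ x)
  refine ⟨2 * M * (k * (Real.exp k).toNNReal + 1), fun σ hσ =>
    LipschitzWith.of_dist_le_mul fun x x' => ?_⟩
  rw [dist_eq_norm, dist_eq_norm]
  push_cast
  rw [Real.coe_toNNReal _ (Real.exp_pos _).le]
  have hH := gaussMass_pos hψ σ x
  have hH' := gaussMass_pos hψ σ x'
  set H := gaussMass ψ σ x
  set H' := gaussMass ψ σ x'
  set P := gaussMoment ψ σ x
  set P' := gaussMoment ψ σ x'
  have hM0 : (0 : ℝ) ≤ M := M.2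
  have hk0 : (0 : ℝ) ≤ k := k.2
  have hmean : ∀ y, ‖gaussMean ψ σ y‖ ≤ M := fun y => by
    have hy := gaussMass_pos hψ σ y
    rw [gaussMean, norm_smul, norm_inv, Real.norm_of_nonneg hy.le, inv_mul_le_iff₀ hy, mul_comm]
    exact hbound σ hσ y
  -- Far apart, boundedness of the mean suffices. Nearby, the factor exp(k‖x - x'‖) is at most exp
  -- k.
  rcases le_total 1 ‖x - x'‖ with h1 | h1
  · calc ‖gaussMean ψ σ x - gaussMean ψ σ x'‖
        ≤ ‖gaussMean ψ σ x‖ + ‖gaussMean ψ σ x'‖ := norm_sub_le _ _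
      _ ≤ 2 * M * 1 * 1 := by linarith [hmean x, hmean x']
      _ ≤ 2 * M * (k * Real.exp k + 1) * ‖x - x'‖ := by
        have : 0 ≤ k * Real.exp k := by positivity
        gcongr
        linarith
  · set r := k * ‖x - x'‖ * Real.exp (k * ‖x - x'‖) with hr
    have hr0 : 0 ≤ r := by positivity
    have hPd : ‖P - P'‖ ≤ r * (M * H') := by
      refine (norm_gaussMoment_sub_le hψ σ x x').trans ?_
      gcongr
      exact hM σ hσ x'
    have hHd : |H - H'| ≤ r * H' := abs_gaussMass_sub_le hψ σ x x'
    have hdecomp : gaussMean ψ σ x - gaussMean ψ σ x' =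
        H'⁻¹ • (P - P') - (H'⁻¹ * (H - H')) • gaussMean ψ σ x := by
      have e1 : gaussMean ψ σ x = H⁻¹ • P := rfl
      have e2 : gaussMean ψ σ x' = H'⁻¹ • P' := rfl
      rw [e1, e2, smul_sub, smul_smul,
        show H'⁻¹ * (H - H') * H⁻¹ = H'⁻¹ - H⁻¹ by field_simp, sub_smul]
      abel
    have hr1 : r ≤ k * Real.exp k * ‖x - x'‖ := by
      rw [hr, mul_right_comm]
      gcongr
      exact mul_le_of_le_one_right hk0 h1
    rw [hdecomp]
    calc ‖H'⁻¹ • (P - P') - (H'⁻¹ * (H - H')) • gaussMean ψ σ x‖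
        ≤ ‖H'⁻¹ • (P - P')‖ + ‖(H'⁻¹ * (H - H')) • gaussMean ψ σ x‖ := norm_sub_le _ _
      _ ≤ H'⁻¹ * (r * (M * H')) + H'⁻¹ * (r * H') * M := by
        rw [norm_smul, norm_smul, norm_mul, norm_inv, Real.norm_of_nonneg hH'.le,
          Real.norm_eq_abs]
        gcongr
        exact hmean x
      _ = 2 * M * r := by field_simp; ring
      _ ≤ 2 * M * (k * Real.exp k * ‖x - x'‖) := by gcongr
      _ ≤ 2 * M * (k * Real.exp k + 1) * ‖x - x'‖ := by
        nlinarith [mul_nonneg hM0 (norm_nonneg (x - x'))]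

/-- Dominated convergence; σ = 0 is included, which makes the rescaled field continuous up to the
initial time. -/
theorem continuous_gaussMean (hψ : LipschitzWith k ψ) (x : V) :
    Continuous (fun σ => gaussMean ψ σ x) := by
  have hc := hψ.continuous
  have hnhds : ∀ σ₀ : ℝ, ∀ᶠ σ in 𝓝 σ₀, |σ| ≤ |σ₀| + 1 := fun σ₀ =>
    (continuous_abs.tendsto σ₀).eventually_le_const (by linarith)
  have hH : Continuous (fun σ => gaussMass ψ σ x) := by
    refine continuous_iff_continuousAt.2 fun σ₀ => ?_
    refine continuousAt_of_dominated (Eventually.of_forall fun σ => by fun_prop)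
      (((hnhds σ₀).mono fun σ hσ => Eventually.of_forall fun w => ?_))
      ((integrable_exp_neg_mul_sq_norm_add (V := V) one_half_pos (k * (|σ₀| + 1))).const_mul
        (Real.exp (ψ x))) (Eventually.of_forall fun w => by fun_prop)
    rw [Real.norm_eq_abs, Real.abs_exp]
    exact gauss_exp_le hψ hσ x w
  have hP : Continuous (fun σ => gaussMoment ψ σ x) := by
    refine continuous_iff_continuousAt.2 fun σ₀ => ?_
    refine continuousAt_of_dominated (Eventually.of_forall fun σ => by fun_prop)
      (((hnhds σ₀).mono fun σ hσ => Eventually.of_forall fun w => ?_))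
      ((integrable_norm_mul_exp_neg_mul_sq_norm_add (V := V) one_half_pos
        (k * (|σ₀| + 1))).const_mul (Real.exp (ψ x))) (Eventually.of_forall fun w => by fun_prop)
    rw [norm_smul, Real.norm_eq_abs, Real.abs_exp, mul_comm, mul_left_comm]
    gcongr
    exact gauss_exp_le hψ hσ x w
  exact (hH.inv₀ fun σ => (gaussMass_pos hψ σ x).ne').smul hP

theorem integral_comp_add_smul {F : Type*} [NormedAddCommGroup F] [NormedSpace ℝ F] (g : V → F)
    {σ : ℝ} (hσ : 0 < σ) (x : V) :
    ∫ y, g y = σ ^ Module.finrank ℝ V • ∫ w, g (x + σ • w) := by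
  rw [Measure.integral_comp_smul volume (fun w => g (x + w)), integral_add_left_eq_self g x,
    abs_of_pos (by positivity), smul_smul, mul_inv_cancel₀ (by positivity), one_smul]

theorem log_gaussMass_lipschitz (hψ : LipschitzWith k ψ) (σ : ℝ) :
    LipschitzWith k (fun x => Real.log (gaussMass ψ σ x)) := by
  refine LipschitzWith.of_le_add_mul k fun x x' => ?_
  have hH := gaussMass_pos hψ σ x
  have hH' := gaussMass_pos hψ σ x'
  rw [Real.log_le_iff_le_exp hH, Real.exp_add, Real.exp_log hH', mul_comm, gaussMass, gaussMass,
    ← integral_const_mul]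
  refine integral_mono (integrable_gauss_exp hψ σ x) ((integrable_gauss_exp hψ σ x').const_mul _)
    fun w => ?_
  simp only
  rw [← Real.exp_add, Real.exp_le_exp]
  have h := hψ.norm_sub_le (x + σ • w) (x' + σ • w)
  rw [add_sub_add_right_eq_sub, Real.norm_eq_abs, ← dist_eq_norm] at h
  linarith [(abs_le.1 h).2]

theorem convexOn_log_gaussMass (hψ : LipschitzWith k ψ) {l : ℝ}
    (hconv : ConvexOn ℝ univ (fun y => ψ y + l / 2 * ‖y‖ ^ 2)) (σ : ℝ) :
    ConvexOn ℝ univ (fun x => Real.log (gaussMass ψ σ x) + l / 2 * ‖x‖ ^ 2) := by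
  have hexp : ∀ x w, Real.exp (-(1 / 2) * ‖w‖ ^ 2 + ψ (x + σ • w) + l / 2 * ‖x‖ ^ 2) =
      Real.exp (l / 2 * ‖x‖ ^ 2) * Real.exp (-(1 / 2) * ‖w‖ ^ 2 + ψ (x + σ • w)) := by
    intro x w
    rw [← Real.exp_add, add_comm]
  have hint : ∀ x, ∫ w, Real.exp (-(1 / 2) * ‖w‖ ^ 2 + ψ (x + σ • w) + l / 2 * ‖x‖ ^ 2) =
      Real.exp (l / 2 * ‖x‖ ^ 2) * gaussMass ψ σ x := by
    intro x
    simp_rw [hexp]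
    rw [integral_const_mul, gaussMass]
  have key := convexOn_log_integral_exp (μ := (volume : Measure V))
    (c := fun x w => -(1 / 2) * ‖w‖ ^ 2 + ψ (x + σ • w) + l / 2 * ‖x‖ ^ 2) ?_ ?_ ?_
  · refine key.congr fun x _ => ?_
    simp only
    rw [hint, Real.log_mul (Real.exp_pos _).ne' (gaussMass_pos hψ σ x).ne', Real.log_exp, add_comm]
  · intro w
    -- ‖x + σ • w‖² and ‖x‖² differ by an affine function of x, so convexity survives the exchange.
    have h1 : ConvexOn ℝ univ (fun x => ψ (x + σ • w) + l / 2 * ‖x + σ • w‖ ^ 2) := by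
      simpa [Function.comp_def] using hconv.translate_left (σ • w)
    refine ⟨convex_univ, fun a _ b _ p q hp hq hpq => ?_⟩
    have h2 := h1.2 (mem_univ a) (mem_univ b) hp hq hpq
    simp only [smul_eq_mul] at h2 ⊢
    rw [norm_add_sq_real, norm_add_sq_real a, norm_add_sq_real b, inner_add_left,
      real_inner_smul_left, real_inner_smul_left] at h2
    have hq' : q = 1 - p := by linarith
    subst hq'
    nlinarith
  · intro x
    simp_rw [hexp]
    exact (integrable_gauss_exp hψ σ x).const_mul _
  · intro x
    rw [hint]
    exact mul_pos (Real.exp_pos _) (gaussMass_pos hψ σ x)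

/-- In the variable y only the Gaussian kernel depends on x, so ψ need not be differentiable. -/
theorem hasFDerivAt_integral_exp_neg_mul_sq_norm_sub (hψ : LipschitzWith k ψ) {b : ℝ}
    (hb : 0 < b) (x : V) :
    HasFDerivAt (fun x => ∫ y, Real.exp (-b * ‖y - x‖ ^ 2 + ψ y))
      (∫ y, (2 * b * Real.exp (-b * ‖y - x‖ ^ 2 + ψ y)) • innerSL ℝ (y - x)) x := by
  have hc := hψ.continuous
  have hlip : ∀ y, ψ y ≤ ψ x + k * ‖y - x‖ := by
    intro y
    have := hψ.norm_sub_le y x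
    rw [Real.norm_eq_abs] at this
    linarith [(abs_le.1 this).2]
  refine hasFDerivAt_integral_of_dominated_of_fderiv_le (μ := (volume : Measure V))
    (F := fun x y => Real.exp (-b * ‖y - x‖ ^ 2 + ψ y))
    (F' := fun x y => (2 * b * Real.exp (-b * ‖y - x‖ ^ 2 + ψ y)) • innerSL ℝ (y - x))
    (bound := fun y => 2 * b * Real.exp (b + ψ x) *
      Real.exp (-(b / 2) * ‖y - x‖ ^ 2 + (k + 1) * ‖y - x‖))
    (Metric.ball_mem_nhds x one_pos) (Eventually.of_forall fun x' => by fun_prop) ?_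
    (by fun_prop) ?_ ?_ ?_
  · refine (((integrable_exp_neg_mul_sq_norm_add (V := V) hb k).comp_sub_right x).const_mul
      (Real.exp (ψ x))).mono' (by fun_prop) (Eventually.of_forall fun y => ?_)
    rw [Real.norm_eq_abs, Real.abs_exp, ← Real.exp_add, Real.exp_le_exp]
    linarith [hlip y]
  · refine Eventually.of_forall fun y x' hx' => ?_
    rw [Metric.mem_ball, dist_eq_norm] at hx'
    have h1 : ‖y - x'‖ ≤ ‖y - x‖ + 1 := by
      calc ‖y - x'‖ = ‖(y - x) - (x' - x)‖ := by congr 1; abel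
        _ ≤ ‖y - x‖ + ‖x' - x‖ := norm_sub_le _ _
        _ ≤ _ := by linarith
    have h2 : ‖y - x‖ ≤ ‖y - x'‖ + 1 := by
      calc ‖y - x‖ = ‖(y - x') + (x' - x)‖ := by congr 1; abel
        _ ≤ ‖y - x'‖ + ‖x' - x‖ := norm_add_le _ _
        _ ≤ _ := by linarith
    -- Half of the quadratic decay survives moving the centre within the unit ball, giving a
    -- dominating function independent of x'.
    have h3 : ‖y - x‖ ^ 2 / 2 - 1 ≤ ‖y - x'‖ ^ 2 := by
      nlinarith [norm_nonneg (y - x), norm_nonneg (y - x'), sq_nonneg (‖y - x'‖ - 1)]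
    have h4 : ‖y - x'‖ ≤ Real.exp ‖y - x‖ := h1.trans (Real.add_one_le_exp _)
    rw [norm_smul, innerSL_apply_norm, Real.norm_eq_abs, abs_of_pos (by positivity)]
    calc 2 * b * Real.exp (-b * ‖y - x'‖ ^ 2 + ψ y) * ‖y - x'‖
        ≤ 2 * b * Real.exp ((b + ψ x) + (-(b / 2) * ‖y - x‖ ^ 2 + k * ‖y - x‖)) *
          Real.exp ‖y - x‖ := by
          have h5 : -b * ‖y - x'‖ ^ 2 + ψ y ≤
              (b + ψ x) + (-(b / 2) * ‖y - x‖ ^ 2 + k * ‖y - x‖) := by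
            nlinarith [hlip y, mul_le_mul_of_nonneg_left h3 hb.le]
          have h6 := Real.exp_le_exp.2 h5
          gcongr
      _ = _ := by
        rw [Real.exp_add, mul_assoc, mul_assoc, mul_assoc, ← Real.exp_add, mul_assoc]
        ring_nf
  · exact ((integrable_exp_neg_mul_sq_norm_add (V := V) (half_pos hb) (k + 1)).comp_sub_right
      x).const_mul _
  · refine Eventually.of_forall fun y x' _ => ?_
    have h1 : HasFDerivAt (fun x : V => ‖y - x‖ ^ 2)
        (2 • (innerSL ℝ (y - x')).comp (-ContinuousLinearMap.id ℝ V)) x' := by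
      simpa using ((hasFDerivAt_id x').const_sub y).norm_sq
    convert! ((h1.const_mul (-b)).add_const (ψ y)).exp using 1
    ext v
    simp
    ring

theorem hasGradientAt_gaussMass (hψ : LipschitzWith k ψ) {σ : ℝ} (hσ : 0 < σ) (x : V) :
    HasGradientAt (gaussMass ψ σ) (σ⁻¹ • gaussMoment ψ σ x) x := by
  have hb : 0 < 1 / (2 * σ ^ 2) := by positivity
  have hexp : ∀ x w : V, -(1 / (2 * σ ^ 2)) * ‖x + σ • w - x‖ ^ 2 + ψ (x + σ • w) =
      -(1 / 2) * ‖w‖ ^ 2 + ψ (x + σ • w) := by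
    intro x w
    rw [add_sub_cancel_left, norm_smul, Real.norm_of_nonneg hσ.le]
    field_simp
  have hH : ∀ x, gaussMass ψ σ x = (σ ^ Module.finrank ℝ V)⁻¹ *
      ∫ y, Real.exp (-(1 / (2 * σ ^ 2)) * ‖y - x‖ ^ 2 + ψ y) := by
    intro x
    rw [integral_comp_add_smul _ hσ x, smul_eq_mul, ← mul_assoc,
      inv_mul_cancel₀ (by positivity), one_mul]
    simp_rw [hexp]
    rfl
  have hder := (hasFDerivAt_integral_exp_neg_mul_sq_norm_sub hψ hb x).const_mul
    (σ ^ Module.finrank ℝ V)⁻¹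
  rw [hasGradientAt_iff_hasFDerivAt, funext hH]
  convert! hder using 1
  rw [integral_comp_add_smul _ hσ x, smul_smul, inv_mul_cancel₀ (by positivity), one_smul]
  simp_rw [hexp, add_sub_cancel_left]
  have h2 : ∀ w : V, (2 * (1 / (2 * σ ^ 2)) * Real.exp (-(1 / 2) * ‖w‖ ^ 2 + ψ (x + σ • w))) •
      innerSL ℝ (σ • w) = (innerSL ℝ : V →L[ℝ] V →L[ℝ] ℝ)
        (σ⁻¹ • (Real.exp (-(1 / 2) * ‖w‖ ^ 2 + ψ (x + σ • w)) • w)) := by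
    intro w
    rw [map_smul, map_smul, map_smul, smul_smul, smul_smul]
    congr 1
    field_simp
  simp_rw [h2]
  have hi : Integrable
      (fun w => σ⁻¹ • (Real.exp (-(1 / 2) * ‖w‖ ^ 2 + ψ (x + σ • w)) • w)) :=
    (integrable_gauss_exp_smul hψ σ x).smul σ⁻¹
  rw [ContinuousLinearMap.integral_comp_comm _ hi, integral_smul]
  rfl

theorem hasGradientAt_log_gaussMass (hψ : LipschitzWith k ψ) {σ : ℝ} (hσ : 0 < σ) (x : V) :
    HasGradientAt (fun x => Real.log (gaussMass ψ σ x)) (σ⁻¹ • gaussMean ψ σ x) x := by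
  have h := (hasGradientAt_gaussMass hψ hσ x).hasFDerivAt.log (gaussMass_pos hψ σ x).ne'
  rw [hasGradientAt_iff_hasFDerivAt]
  convert! h using 1
  rw [gaussMean, smul_comm, map_smul]

end GaussianTransform

/-! ### Two-sided bounds on the Gaussian mass for the small-viscosity limit. -/

section GaussianBounds

variable {V : Type*} [NormedAddCommGroup V] [InnerProductSpace ℝ V] [FiniteDimensional ℝ V]
  [MeasurableSpace V] [BorelSpace V] {ψ : V → ℝ} {k : ℝ≥0}

theorem integral_exp_neg_half_mul_sq_norm :
    ∫ w : V, Real.exp (-(1 / 2) * ‖w‖ ^ 2) =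
      (2 * Real.pi) ^ ((Module.finrank ℝ V : ℝ) / 2) := by
  rw [GaussianFourier.integral_rexp_neg_mul_sq_norm one_half_pos]
  congr 1
  ring

/-- Recentre the Gaussian at p and bound the cross term by exp(-⟨p, w⟩) ≥ 1 - ⟨p, w⟩, whose odd part
integrates to zero. As p is arbitrary, no minimiser in the Hopf-Lax formula is needed. -/
theorem exp_mul_integral_le_gaussMass (hψ : LipschitzWith k ψ) {σ : ℝ} (hσ : 0 ≤ σ) (x p : V) :
    Real.exp (-(1 / 2) * ‖p‖ ^ 2 + ψ (x + σ • p)) *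
      ∫ w : V, Real.exp (-(1 / 2) * ‖w‖ ^ 2 + -(k * σ) * ‖w‖) ≤ gaussMass ψ σ x := by
  set c : ℝ := -(k * σ) with hc
  have hi := integrable_exp_neg_mul_sq_norm_add (V := V) one_half_pos c
  have hi' : Integrable
      (fun w : V => Real.exp (-(1 / 2) * ‖w‖ ^ 2 + c * ‖w‖) * inner ℝ p w) := by
    refine ((integrable_norm_mul_exp_neg_mul_sq_norm_add (V := V) one_half_pos c).const_mul
      ‖p‖).mono' (by fun_prop) (Eventually.of_forall fun w => ?_)
    rw [norm_mul, Real.norm_eq_abs, Real.abs_exp]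
    have := norm_inner_le_norm (𝕜 := ℝ) p w
    have h0 := Real.exp_pos (-(1 / 2) * ‖w‖ ^ 2 + c * ‖w‖)
    nlinarith
  have hodd : ∫ w : V, Real.exp (-(1 / 2) * ‖w‖ ^ 2 + c * ‖w‖) * inner ℝ p w = 0 := by
    have h := integral_neg_eq_self
      (fun w : V => Real.exp (-(1 / 2) * ‖w‖ ^ 2 + c * ‖w‖) * inner ℝ p w) volume
    simp only [norm_neg, inner_neg_right, mul_neg, integral_neg] at h
    linarith
  have hshift : gaussMass ψ σ x =
      ∫ w, Real.exp (-(1 / 2) * ‖p + w‖ ^ 2 + ψ (x + σ • (p + w))) :=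
    (integral_add_left_eq_self
      (fun w => Real.exp (-(1 / 2) * ‖w‖ ^ 2 + ψ (x + σ • w))) p).symm
  have hsum : ∫ w : V, (Real.exp (-(1 / 2) * ‖w‖ ^ 2 + c * ‖w‖) -
      Real.exp (-(1 / 2) * ‖w‖ ^ 2 + c * ‖w‖) * inner ℝ p w) =
      ∫ w : V, Real.exp (-(1 / 2) * ‖w‖ ^ 2 + c * ‖w‖) := by
    rw [integral_sub hi hi', hodd, sub_zero]
  rw [← hsum, hshift, ← integral_const_mul]
  refine integral_mono ((hi.sub hi').const_mul _)
    ((integrable_gauss_exp hψ σ x).comp_add_left p) fun w => ?_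
  simp only
  have h1 : 1 - inner ℝ p w ≤ Real.exp (-inner ℝ p w) := by
    linarith [Real.add_one_le_exp (-inner ℝ p w)]
  have h2 := abs_sub_le_of_lipschitz hψ σ (x + σ • p) w
  rw [abs_of_nonneg hσ, abs_le, add_assoc, ← smul_add] at h2
  have h3 := norm_add_sq_real p w
  have h4 := Real.exp_pos (-(1 / 2) * ‖w‖ ^ 2 + c * ‖w‖)
  calc Real.exp (-(1 / 2) * ‖p‖ ^ 2 + ψ (x + σ • p)) *
        (Real.exp (-(1 / 2) * ‖w‖ ^ 2 + c * ‖w‖) -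
          Real.exp (-(1 / 2) * ‖w‖ ^ 2 + c * ‖w‖) * inner ℝ p w)
      ≤ Real.exp (-(1 / 2) * ‖p‖ ^ 2 + ψ (x + σ • p)) *
        (Real.exp (-(1 / 2) * ‖w‖ ^ 2 + c * ‖w‖) * Real.exp (-inner ℝ p w)) := by
        gcongr
        nlinarith
    _ ≤ _ := by
      rw [← Real.exp_add, ← Real.exp_add, Real.exp_le_exp]
      linarith [h2.1]

/-- Jensen's inequality for the Gaussian law, through the tangent line of exp at the mean m of ‖w‖.
-/
theorem le_integral_exp_neg_mul_norm (c : ℝ) :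
    Real.exp (-c * ((∫ w : V, Real.exp (-(1 / 2) * ‖w‖ ^ 2))⁻¹ *
      ∫ w : V, ‖w‖ * Real.exp (-(1 / 2) * ‖w‖ ^ 2))) *
      ∫ w : V, Real.exp (-(1 / 2) * ‖w‖ ^ 2) ≤
      ∫ w : V, Real.exp (-(1 / 2) * ‖w‖ ^ 2 + -c * ‖w‖) := by
  have hi0 := integrable_exp_neg_mul_sq_norm (V := V) one_half_pos
  have hi1 : Integrable (fun w : V => ‖w‖ * Real.exp (-(1 / 2) * ‖w‖ ^ 2)) := by
    simpa using integrable_norm_mul_exp_neg_mul_sq_norm_add (V := V) one_half_pos 0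
  have hZ : 0 < ∫ w : V, Real.exp (-(1 / 2) * ‖w‖ ^ 2) := integral_exp_pos hi0
  set Z := ∫ w : V, Real.exp (-(1 / 2) * ‖w‖ ^ 2)
  set I := ∫ w : V, ‖w‖ * Real.exp (-(1 / 2) * ‖w‖ ^ 2)
  set m := Z⁻¹ * I with hm
  have hIm : I = m * Z := by rw [hm]; field_simp
  have hsum : ∫ w : V, Real.exp (-c * m) * ((1 + c * m) * Real.exp (-(1 / 2) * ‖w‖ ^ 2) -
      c * (‖w‖ * Real.exp (-(1 / 2) * ‖w‖ ^ 2))) = Real.exp (-c * m) * Z := by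
    rw [integral_const_mul, integral_sub (hi0.const_mul _) (hi1.const_mul _),
      integral_const_mul, integral_const_mul]
    change Real.exp (-c * m) * ((1 + c * m) * Z - c * I) = _
    rw [hIm]
    ring
  rw [← hsum]
  refine integral_mono (((hi0.const_mul _).sub (hi1.const_mul _)).const_mul _)
    (integrable_exp_neg_mul_sq_norm_add (V := V) one_half_pos (-c)) fun w => ?_
  simp only
  have h1 := Real.add_one_le_exp (c * m - c * ‖w‖)
  have h2 : Real.exp (-(1 / 2) * ‖w‖ ^ 2 + -c * ‖w‖) = Real.exp (-c * m) *
      (Real.exp (c * m - c * ‖w‖) * Real.exp (-(1 / 2) * ‖w‖ ^ 2)) := by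
    rw [← Real.exp_add, ← Real.exp_add]; ring_nf
  rw [h2, show (1 + c * m) * Real.exp (-(1 / 2) * ‖w‖ ^ 2) -
    c * (‖w‖ * Real.exp (-(1 / 2) * ‖w‖ ^ 2)) =
    (c * m - c * ‖w‖ + 1) * Real.exp (-(1 / 2) * ‖w‖ ^ 2) by ring]
  gcongr

theorem gaussMass_le (hψ : LipschitzWith k ψ) {σ : ℝ} {x : V} {A B θ : ℝ} (hθ : 0 < θ)
    (h : ∀ w, -(1 / 2) * ‖w‖ ^ 2 + ψ (x + σ • w) ≤ A + (B - θ * (‖w‖ ^ 2 / 4))) :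
    gaussMass ψ σ x ≤ Real.exp (A + B) *
      ((2 / θ) * (2 * Real.pi)) ^ ((Module.finrank ℝ V : ℝ) / 2) := by
  have hb : 0 < θ / 4 := by positivity
  rw [show (2 / θ) * (2 * Real.pi) = Real.pi / (θ / 4) by field_simp; norm_num,
    ← GaussianFourier.integral_rexp_neg_mul_sq_norm hb, ← integral_const_mul]
  refine integral_mono (integrable_gauss_exp hψ σ x)
    ((integrable_exp_neg_mul_sq_norm (V := V) hb).const_mul _) fun w => ?_
  simp only
  rw [← Real.exp_add, Real.exp_le_exp]
  linarith [h w]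

end GaussianBounds

/-! ### The Cole-Hopf potential: gradient, semiconcavity, comparison with Hopf-Lax. -/

section ColeHopf

variable {d : ℕ} {φ : EuclideanSpace ℝ (Fin d) → ℝ} {K : ℝ≥0} {lam ε t : ℝ}

theorem lipschitzWith_neg_div (hK : LipschitzWith K φ) (hε : 0 < ε) :
    LipschitzWith (K / ε.toNNReal) (fun y => -φ y / ε) := by
  refine LipschitzWith.of_dist_le_mul fun x y => ?_
  have h := hK.dist_le_mul x y
  rw [Real.dist_eq] at h ⊢
  rw [NNReal.coe_div, Real.coe_toNNReal _ hε.le,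
    show -φ x / ε - -φ y / ε = -(φ x - φ y) / ε by ring, abs_div, abs_neg, abs_of_pos hε,
    div_mul_eq_mul_div]
  gcongr

/-- The substitution y = x + σw with σ² = εt; the powers of σ cancel against the heat-kernel
normalisation. -/
theorem colePotential_eq (hK : LipschitzWith K φ) (hε : 0 < ε) (ht : 0 < t)
    (x : EuclideanSpace ℝ (Fin d)) :
    colePotential φ ε t x = ε * (d / 2 * Real.log (2 * Real.pi)) -
      ε * Real.log (gaussMass (fun y => -φ y / ε) √(ε * t) x) := by
  have hεt : 0 < ε * t := mul_pos hε ht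
  set σ := √(ε * t) with hσ
  have hσ0 : 0 < σ := Real.sqrt_pos.2 hεt
  have hσ2 : σ ^ 2 = ε * t := Real.sq_sqrt hεt.le
  have hH := gaussMass_pos (lipschitzWith_neg_div hK hε) σ x
  have hint : ∫ y, Real.exp (-‖x - y‖ ^ 2 / (2 * ε * t) - φ y / ε) =
      σ ^ d * gaussMass (fun y => -φ y / ε) σ x := by
    rw [integral_comp_add_smul _ hσ0 x, finrank_euclideanSpace_fin, smul_eq_mul, gaussMass]
    congr 1
    refine integral_congr_ae (Eventually.of_forall fun w => ?_)
    simp only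
    rw [sub_add_cancel_left, norm_neg, norm_smul, Real.norm_of_nonneg hσ0.le, mul_pow, hσ2]
    congr 1
    field_simp
    ring
  have hpow : (2 * Real.pi * ε * t) ^ ((d : ℝ) / 2) =
      (2 * Real.pi) ^ ((d : ℝ) / 2) * σ ^ d := by
    rw [show 2 * Real.pi * ε * t = 2 * Real.pi * (σ ^ 2) by rw [hσ2]; ring,
      Real.mul_rpow (by positivity) (by positivity), ← Real.rpow_natCast σ 2,
      ← Real.rpow_mul hσ0.le, ← Real.rpow_natCast σ d]
    congr 2
    push_cast
    ring
  have hpi : 0 < (2 * Real.pi) ^ ((d : ℝ) / 2) := by positivity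
  rw [colePotential, hint, hpow, show 1 / ((2 * Real.pi) ^ ((d : ℝ) / 2) * σ ^ d) *
    (σ ^ d * gaussMass (fun y => -φ y / ε) σ x) =
    ((2 * Real.pi) ^ ((d : ℝ) / 2))⁻¹ * gaussMass (fun y => -φ y / ε) σ x by
      field_simp, Real.log_mul (by positivity) hH.ne', Real.log_inv,
    Real.log_rpow (by positivity)]
  ring

theorem hasGradientAt_colePotential (hK : LipschitzWith K φ) (hε : 0 < ε) (ht : 0 < t)
    (x : EuclideanSpace ℝ (Fin d)) :
    HasGradientAt (colePotential φ ε t)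
      (-(ε / √(ε * t)) • gaussMean (fun y => -φ y / ε) √(ε * t) x) x := by
  have hσ0 : 0 < √(ε * t) := Real.sqrt_pos.2 (mul_pos hε ht)
  have h := hasGradientAt_log_gaussMass (lipschitzWith_neg_div hK hε) hσ0 x
  rw [hasGradientAt_iff_hasFDerivAt] at h ⊢
  rw [funext (colePotential_eq hK hε ht)]
  convert! (h.const_mul ε).const_sub (ε * (d / 2 * Real.log (2 * Real.pi))) using 1
  rw [map_smul, map_smul, smul_smul, neg_smul, div_eq_mul_inv]

theorem velocity_eq (hK : LipschitzWith K φ) (hε : 0 < ε) (ht : 0 < t)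
    (x : EuclideanSpace ℝ (Fin d)) :
    velocity φ ε t x = -(ε / √(ε * t)) • gaussMean (fun y => -φ y / ε) √(ε * t) x :=
  (hasGradientAt_colePotential hK hε ht x).gradient

theorem hasFDerivAt_colePotential (hK : LipschitzWith K φ) (hε : 0 < ε) (ht : 0 < t)
    (x : EuclideanSpace ℝ (Fin d)) :
    HasFDerivAt (colePotential φ ε t) (innerSL ℝ (velocity φ ε t x)) x := by
  rw [velocity_eq hK hε ht]
  exact (hasGradientAt_colePotential hK hε ht x).hasFDerivAt

theorem lipschitzWith_colePotential (hK : LipschitzWith K φ) (hε : 0 < ε) (ht : 0 < t) :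
    LipschitzWith K (colePotential φ ε t) := by
  refine LipschitzWith.of_dist_le_mul fun x y => ?_
  have h := (log_gaussMass_lipschitz (lipschitzWith_neg_div hK hε) √(ε * t)).dist_le_mul x y
  rw [Real.dist_eq, NNReal.coe_div, Real.coe_toNNReal _ hε.le, div_mul_eq_mul_div,
    le_div_iff₀ hε] at h
  rw [Real.dist_eq, colePotential_eq hK hε ht, colePotential_eq hK hε ht,
    sub_sub_sub_cancel_left, ← mul_sub, abs_mul, abs_of_pos hε, abs_sub_comm]
  linarith

theorem norm_velocity_le (hK : LipschitzWith K φ) (hε : 0 < ε) (ht : 0 < t)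
    (x : EuclideanSpace ℝ (Fin d)) : ‖velocity φ ε t x‖ ≤ K := by
  have h := norm_fderiv_le_of_lipschitz ℝ (lipschitzWith_colePotential hK hε ht) (x₀ := x)
  rwa [(hasFDerivAt_colePotential hK hε ht x).fderiv, innerSL_apply_norm] at h

theorem LambdaConcave.colePotential (hφ : LambdaConcave lam φ) (hK : LipschitzWith K φ)
    (hε : 0 < ε) (ht : 0 < t) : LambdaConcave lam (colePotential φ ε t) := by
  have hconv : ConvexOn ℝ univ (fun y => -φ y / ε + (lam / ε) / 2 * ‖y‖ ^ 2) := by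
    have h := (ConcaveOn.neg hφ).smul (c := ε⁻¹) (by positivity)
    refine h.congr fun y _ => ?_
    simp only [Pi.neg_apply, smul_eq_mul]
    field_simp
    ring
  have h := (convexOn_log_gaussMass (lipschitzWith_neg_div hK hε) hconv √(ε * t)).smul hε.le
  have h2 := (ConvexOn.neg h).add_const (ε * (d / 2 * Real.log (2 * Real.pi)))
  refine h2.congr fun x _ => ?_
  simp only [Pi.neg_apply, Pi.add_apply, smul_eq_mul]
  rw [colePotential_eq hK hε ht]
  field_simp
  ring

theorem LambdaConcave.le_add_inner {u : EuclideanSpace ℝ (Fin d) → ℝ}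
    (hu : LambdaConcave lam u) {a v : EuclideanSpace ℝ (Fin d)}
    (hv : HasFDerivAt u (innerSL ℝ v) a) (b : EuclideanSpace ℝ (Fin d)) :
    u b ≤ u a + inner ℝ v (b - a) + lam / 2 * ‖b - a‖ ^ 2 := by
  have hline : ConvexOn ℝ univ (fun s : ℝ => -(u (a + s • (b - a)) -
      lam / 2 * ‖a + s • (b - a)‖ ^ 2)) := by
    have h := (ConcaveOn.neg hu).comp_affineMap (AffineMap.lineMap a b : ℝ →ᵃ[ℝ] _)
    refine h.congr fun s _ => ?_
    simp [AffineMap.lineMap_apply, add_comm]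
  have hpath : HasDerivAt (fun s : ℝ => a + s • (b - a)) (b - a) 0 := by
    simpa using ((hasDerivAt_id (0 : ℝ)).smul_const (b - a)).const_add a
  have hd1 : HasDerivAt (fun s : ℝ => u (a + s • (b - a))) (inner ℝ v (b - a)) 0 := by
    have hv' : HasFDerivAt u (innerSL ℝ v) (a + (0 : ℝ) • (b - a)) := by simpa using hv
    simpa [Function.comp_def] using hv'.comp_hasDerivAt 0 hpath
  have hd2 : HasDerivAt (fun s : ℝ => ‖a + s • (b - a)‖ ^ 2) (2 * inner ℝ a (b - a)) 0 := by
    simpa using hpath.norm_sq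
  have hd := (hd1.sub (hd2.const_mul (lam / 2))).neg
  have h := hline.le_slope_of_hasDerivAt (mem_univ 0) (mem_univ 1) one_pos hd
  rw [slope_def_field] at h
  simp only [one_smul, zero_smul, add_zero, add_sub_cancel, sub_zero, div_one] at h
  have h2 := norm_sub_sq_real b a
  have h3 : inner ℝ a (b - a) = inner ℝ b a - ‖a‖ ^ 2 := by
    rw [inner_sub_right, real_inner_self_eq_norm_sq, real_inner_comm]
  rw [h3] at h
  rw [h2]
  linarith

/-- The Hopf-Lax formula for the inviscid potential. -/
noncomputable def hopfLax (φ : EuclideanSpace ℝ (Fin d) → ℝ) (t : ℝ)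
    (x : EuclideanSpace ℝ (Fin d)) : ℝ :=
  ⨅ y, (‖x - y‖ ^ 2 / (2 * t) + φ y)

/-- Half of the quadratic term absorbs the Lipschitz growth of φ by completing a square. The other
half remains as decay. -/
theorem le_hopfLax_integrand (hK : LipschitzWith K φ) (ht : 0 < t)
    (x y : EuclideanSpace ℝ (Fin d)) :
    φ x + (‖x - y‖ ^ 2 / (4 * t) - K ^ 2 * t) ≤ ‖x - y‖ ^ 2 / (2 * t) + φ y := by
  have h := hK.norm_sub_le x y
  rw [Real.norm_eq_abs, abs_le] at h
  have h2 : ‖x - y‖ ^ 2 / (2 * t) + K ^ 2 * t - K * ‖x - y‖ - ‖x - y‖ ^ 2 / (4 * t) =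
      (‖x - y‖ - 2 * K * t) ^ 2 / (4 * t) := by field_simp; ring
  have h3 : 0 ≤ (‖x - y‖ - 2 * K * t) ^ 2 / (4 * t) := by positivity
  linarith [h.2]

theorem hopfLax_le (hK : LipschitzWith K φ) (ht : 0 < t) (x y : EuclideanSpace ℝ (Fin d)) :
    hopfLax φ t x ≤ ‖x - y‖ ^ 2 / (2 * t) + φ y := by
  refine ciInf_le ⟨φ x - K ^ 2 * t, ?_⟩ y
  rintro _ ⟨y, rfl⟩
  have h : 0 ≤ ‖x - y‖ ^ 2 / (4 * t) := by positivity
  have := le_hopfLax_integrand hK ht x y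
  simp only
  linarith

theorem le_colePotential (hK : LipschitzWith K φ) (hε : 0 < ε) (hε1 : ε ≤ 1) (ht : 0 < t)
    (x : EuclideanSpace ℝ (Fin d)) :
    hopfLax φ t x - ε * (d / 2 * Real.log (2 / ε)) - ε * (K ^ 2 * t) ≤
      colePotential φ ε t x := by
  have hεt : 0 < ε * t := mul_pos hε ht
  have hlip := lipschitzWith_neg_div hK hε
  rw [colePotential_eq hK hε ht]
  set σ := √(ε * t) with hσ
  have hσ0 : 0 < σ := Real.sqrt_pos.2 hεt
  have hσ2 : σ ^ 2 = ε * t := Real.sq_sqrt hεt.le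
  have h := gaussMass_le hlip (σ := σ) (x := x) (A := -hopfLax φ t x / ε) (B := K ^ 2 * t)
    hε fun w => by
      set m := hopfLax φ t x
      have h1 := hopfLax_le hK ht x (x + σ • w)
      have h2 := le_hopfLax_integrand hK ht x (x + σ • w)
      have h3 := hopfLax_le hK ht x x
      rw [sub_add_cancel_left, norm_neg, norm_smul, Real.norm_of_nonneg hσ0.le, mul_pow,
        hσ2] at h1 h2
      rw [sub_self, norm_zero] at h3
      have e1 : ε * t * ‖w‖ ^ 2 / (2 * t) = ε * (‖w‖ ^ 2 / 2) := by field_simp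
      have e2 : ε * t * ‖w‖ ^ 2 / (4 * t) = ε * (‖w‖ ^ 2 / 4) := by field_simp
      rw [e1] at h1 h2
      rw [e2] at h2
      -- The right side dominates both 0 and Q, hence εQ because ε ≤ 1. Dividing by ε leaves decay
      -- ε‖w‖²/4 in the exponent, at the price of a term of order ε log(2/ε) in the potential.
      have h4 : ε * (ε * (‖w‖ ^ 2 / 4) - K ^ 2 * t) ≤
          ε * (‖w‖ ^ 2 / 2) + φ (x + σ • w) - m := by
        set Q := ε * (‖w‖ ^ 2 / 4) - K ^ 2 * t
        rcases le_total 0 Q with hQ | hQ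
        · have : ε * Q ≤ Q := mul_le_of_le_one_left hQ hε1
          norm_num at h3
          linarith
        · have : ε * Q ≤ 0 := mul_nonpos_of_nonneg_of_nonpos hε.le hQ
          linarith
      have h5 := mul_le_mul_of_nonneg_left h4 (inv_pos.2 hε).le
      rw [show ε⁻¹ * (ε * (ε * (‖w‖ ^ 2 / 4) - K ^ 2 * t)) = ε * (‖w‖ ^ 2 / 4) - K ^ 2 * t by
        field_simp, show ε⁻¹ * (ε * (‖w‖ ^ 2 / 2) + φ (x + σ • w) - m) =
        ‖w‖ ^ 2 / 2 + φ (x + σ • w) / ε - m / ε by field_simp] at h5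
      rw [neg_div, neg_div]
      linarith
  rw [finrank_euclideanSpace_fin] at h
  have hlog := Real.log_le_log (gaussMass_pos hlip σ x) h
  rw [Real.log_mul (Real.exp_pos _).ne' (by positivity), Real.log_exp,
    Real.log_rpow (by positivity), Real.log_mul (by positivity) (by positivity)] at hlog
  have h6 := mul_le_mul_of_nonneg_left hlog hε.le
  rw [mul_add, mul_add, mul_div_cancel₀ _ hε.ne'] at h6
  linarith

theorem exists_colePotential_le (hK : LipschitzWith K φ) : ∃ C : ℝ, 0 ≤ C ∧
    ∀ ε t : ℝ, 0 < ε → 0 < t → ∀ x, colePotential φ ε t x ≤ hopfLax φ t x + C * √(ε * t) := by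
  set Z := ∫ w : EuclideanSpace ℝ (Fin d), Real.exp (-(1 / 2) * ‖w‖ ^ 2) with hZ
  set I := ∫ w : EuclideanSpace ℝ (Fin d), ‖w‖ * Real.exp (-(1 / 2) * ‖w‖ ^ 2) with hI
  have hZpos : 0 < Z := integral_exp_pos (integrable_exp_neg_mul_sq_norm one_half_pos)
  have hI0 : 0 ≤ I := integral_nonneg fun w => by positivity
  have hlogZ : Real.log Z = d / 2 * Real.log (2 * Real.pi) := by
    rw [hZ, integral_exp_neg_half_mul_sq_norm, Real.log_rpow (by positivity),
      finrank_euclideanSpace_fin]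
  refine ⟨K * (Z⁻¹ * I), by positivity, fun ε t hε ht x => ?_⟩
  have hεt : 0 < ε * t := mul_pos hε ht
  have hlip := lipschitzWith_neg_div hK hε
  rw [colePotential_eq hK hε ht, ← sub_le_iff_le_add]
  set σ := √(ε * t) with hσ
  have hσ0 : 0 < σ := Real.sqrt_pos.2 hεt
  have hσ2 : σ ^ 2 = ε * t := Real.sq_sqrt hεt.le
  refine le_ciInf fun y => ?_
  -- This choice of p puts the centre x + σp at the competitor y.
  have h1 := exp_mul_integral_le_gaussMass hlip hσ0.le x (σ⁻¹ • (y - x))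
  have h2 := le_integral_exp_neg_mul_norm (V := EuclideanSpace ℝ (Fin d))
    ((K / ε.toNNReal : ℝ≥0) * σ)
  have h3 := (mul_le_mul_of_nonneg_left h2 (Real.exp_pos _).le).trans h1
  have hlog := Real.log_le_log (by positivity) h3
  rw [← hZ, ← hI, Real.log_mul (Real.exp_pos _).ne' (by positivity), Real.log_exp,
    Real.log_mul (Real.exp_pos _).ne' hZpos.ne', Real.log_exp, hlogZ, smul_smul,
    mul_inv_cancel₀ hσ0.ne', one_smul, add_sub_cancel, norm_smul, norm_inv,
    Real.norm_of_nonneg hσ0.le, mul_pow, inv_pow, hσ2, NNReal.coe_div,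
    Real.coe_toNNReal _ hε.le, norm_sub_rev] at hlog
  have h6 := mul_le_mul_of_nonneg_left hlog hε.le
  have e : ε * (-(1 / 2) * ((ε * t)⁻¹ * ‖x - y‖ ^ 2) + -φ y / ε + (-(K / ε * σ) * (Z⁻¹ * I) +
      d / 2 * Real.log (2 * Real.pi))) = -(‖x - y‖ ^ 2 / (2 * t)) - φ y - K * (Z⁻¹ * I) * σ +
      ε * (d / 2 * Real.log (2 * Real.pi)) := by
    field_simp
    ring
  rw [e] at h6
  linarith

theorem exists_abs_colePotential_sub_hopfLax_le (hK : LipschitzWith K φ) (T : ℝ) :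
    ∃ η : ℝ → ℝ, Tendsto η (𝓝[>] 0) (𝓝 0) ∧ ∀ ε t : ℝ, 0 < ε → ε ≤ 1 → 0 < t → t ≤ T →
      ∀ x, |colePotential φ ε t x - hopfLax φ t x| ≤ η ε := by
  obtain ⟨C, hC, hup⟩ := exists_colePotential_le hK
  refine ⟨fun ε => ε * (d / 2 * Real.log (2 / ε)) + ε * (K ^ 2 * T) + C * √(ε * T), ?_, ?_⟩
  · have h1 : Tendsto (fun ε : ℝ => ε * (d / 2 * Real.log (2 / ε))) (𝓝[>] 0) (𝓝 0) := by
      have ha : Tendsto (fun ε : ℝ => d / 2 * (Real.log 2 * ε - Real.log ε * ε)) (𝓝[>] 0)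
          (𝓝 (d / 2 * (Real.log 2 * 0 - 0))) := by
        refine ((((tendsto_id.mono_left nhdsWithin_le_nhds).const_mul _).sub ?_).const_mul _)
        simpa using tendsto_log_mul_rpow_nhdsGT_zero one_pos
      rw [mul_zero, sub_zero, mul_zero] at ha
      refine ha.congr' ?_
      filter_upwards [self_mem_nhdsWithin] with ε hε
      rw [Real.log_div two_ne_zero (ne_of_gt hε)]
      ring
    have h2 : Tendsto (fun ε : ℝ => ε * (K ^ 2 * T) + C * √(ε * T)) (𝓝[>] 0) (𝓝 0) := by
      have : Continuous (fun ε : ℝ => ε * (K ^ 2 * T) + C * √(ε * T)) := by fun_prop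
      simpa using (this.tendsto 0).mono_left nhdsWithin_le_nhds
    simpa [add_assoc] using h1.add h2
  · intro ε t hε hε1 ht htT x
    have h1 := le_colePotential hK hε hε1 ht x
    have h2 := hup ε t hε ht x
    have hT : 0 < T := ht.trans_le htT
    have h3 : ε * (K ^ 2 * t) ≤ ε * (K ^ 2 * T) := by gcongr
    have h4 : C * √(ε * t) ≤ C * √(ε * T) := by gcongr
    have h5 : 0 ≤ Real.log (2 / ε) := Real.log_nonneg (by rw [le_div_iff₀ hε]; linarith)
    have h6 : 0 ≤ ε * (d / 2 * Real.log (2 / ε)) := by positivity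
    have h7 : 0 ≤ ε * (K ^ 2 * T) := by positivity
    have h8 : 0 ≤ C * √(ε * T) := by positivity
    rw [abs_le]
    constructor <;> linarith

end ColeHopf

/-! ### Pushforwards under maps of bounded displacement. -/

section BoundedDisplacement

variable {E : Type*} [NormedAddCommGroup E] [NormedSpace ℝ E] [FiniteDimensional ℝ E]
  [MeasurableSpace E] [BorelSpace E] {μ : Measure E} [IsLocallyFiniteMeasure μ]

theorem isLocallyFiniteMeasure_map_of_norm_sub_le {F : E → E} {R : ℝ} (hF : Measurable F)
    (hR : ∀ y, ‖F y - y‖ ≤ R) : IsLocallyFiniteMeasure (Measure.map F μ) := by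
  refine ⟨fun x => ⟨Metric.closedBall x 1, Metric.closedBall_mem_nhds x one_pos, ?_⟩⟩
  rw [Measure.map_apply hF Metric.isClosed_closedBall.measurableSet]
  refine (measure_mono (t := Metric.closedBall x (1 + R)) fun y hy => ?_).trans_lt
    (isCompact_closedBall x (1 + R)).measure_lt_top
  have h1 : dist (F y) x ≤ 1 := hy
  have h2 := hR y
  rw [← dist_eq_norm, dist_comm] at h2
  exact (dist_triangle y (F y) x).trans (by linarith)

/-- A point mapped into the support of g started within R of it, so all integrands vanish outside
one fixed ball and dominated convergence applies. -/
theorem tendsto_integral_comp_of_norm_sub_le {ι : Type*} {l : Filter ι}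
    [l.IsCountablyGenerated] {F : ι → E → E} {G : E → E} {R : ℝ}
    (hF : ∀ᶠ i in l, Measurable (F i)) (hR : ∀ᶠ i in l, ∀ y, ‖F i y - y‖ ≤ R)
    (hlim : ∀ y, Tendsto (fun i => F i y) l (𝓝 (G y))) {g : E → ℝ} (hg : Continuous g)
    (hgc : HasCompactSupport g) :
    Tendsto (fun i => ∫ y, g (F i y) ∂μ) l (𝓝 (∫ y, g (G y) ∂μ)) := by
  obtain ⟨M, hM⟩ := hg.bounded_above_of_compact_support hgc
  obtain ⟨r, hr⟩ := hgc.isBounded.subset_closedBall 0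
  refine tendsto_integral_filter_of_dominated_convergence
    ((Metric.closedBall (0 : E) (r + R)).indicator fun _ => M) ?_ ?_ ?_ ?_
  · exact hF.mono fun i hi => (hg.measurable.comp hi).aestronglyMeasurable
  · refine hR.mono fun i hi => Eventually.of_forall fun y => ?_
    by_cases hy : y ∈ Metric.closedBall (0 : E) (r + R)
    · rw [indicator_of_mem hy]
      exact hM _
    · rw [indicator_of_notMem hy]
      have : g (F i y) = 0 := by
        refine image_eq_zero_of_notMem_tsupport fun h => hy ?_
        have h1 := hr h
        have h2 := hi y
        rw [mem_closedBall_zero_iff] at h1 ⊢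
        calc ‖y‖ = ‖F i y - (F i y - y)‖ := by rw [sub_sub_cancel]
          _ ≤ ‖F i y‖ + ‖F i y - y‖ := norm_sub_le _ _
          _ ≤ r + R := add_le_add h1 h2
      rw [this, norm_zero]
  · rw [integrable_indicator_iff Metric.isClosed_closedBall.measurableSet]
    exact integrableOn_const (isCompact_closedBall _ _).measure_lt_top.ne
  · exact Eventually.of_forall fun y => (hg.tendsto _).comp (hlim y)

end BoundedDisplacement

/-! ### The viscous flow: existence, regularity, and the Cauchy property as ε → 0. -/

section Flow

variable {d : ℕ} {φ : EuclideanSpace ℝ (Fin d) → ℝ} {K : ℝ≥0} {lam ε δ t T : ℝ}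
  {Y Y' : EuclideanSpace ℝ (Fin d) → ℝ → EuclideanSpace ℝ (Fin d)}

/-- The velocity field in the time variable `s = √t`, in which it is regular up to `s = 0`. -/
noncomputable def rescaledVelocity (φ : EuclideanSpace ℝ (Fin d) → ℝ) (ε s : ℝ)
    (x : EuclideanSpace ℝ (Fin d)) : EuclideanSpace ℝ (Fin d) :=
  -(2 * √ε) • gaussMean (fun y => -φ y / ε) (√ε * s) x

theorem rescaledVelocity_eq (hK : LipschitzWith K φ) (hε : 0 < ε) {s : ℝ} (hs : 0 < s)
    (x : EuclideanSpace ℝ (Fin d)) :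
    rescaledVelocity φ ε s x = (2 * s) • velocity φ ε (s ^ 2) x := by
  have h0 : 0 < √ε := Real.sqrt_pos.2 hε
  rw [velocity_eq hK hε (by positivity), Real.sqrt_mul hε.le, Real.sqrt_sq hs.le,
    rescaledVelocity, smul_smul]
  congr 1
  nth_rw 2 [← Real.mul_self_sqrt hε.le]
  field_simp

theorem abs_sqrt_mul_le {s S : ℝ} (hs : s ∈ Icc 0 S) : |√ε * s| ≤ √ε * S := by
  rw [abs_of_nonneg (mul_nonneg (Real.sqrt_nonneg _) hs.1)]
  exact mul_le_mul_of_nonneg_left hs.2 (Real.sqrt_nonneg _)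

theorem exists_lipschitzWith_rescaledVelocity (hK : LipschitzWith K φ) (hε : 0 < ε) (S : ℝ) :
    ∃ L : ℝ≥0, ∀ s ∈ Icc 0 S, LipschitzWith L (rescaledVelocity φ ε s) := by
  obtain ⟨L, hL⟩ := exists_lipschitzWith_gaussMean (lipschitzWith_neg_div hK hε) (√ε * S)
  exact ⟨_, fun s hs => (lipschitzWith_smul (-(2 * √ε))).comp (hL _ (abs_sqrt_mul_le hs))⟩

theorem exists_norm_rescaledVelocity_le (hK : LipschitzWith K φ) (hε : 0 < ε) (S : ℝ) :
    ∃ B : ℝ≥0, ∀ s ∈ Icc 0 S, ∀ x, ‖rescaledVelocity φ ε s x‖ ≤ B := by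
  obtain ⟨M, hM⟩ := exists_norm_gaussMean_le (lipschitzWith_neg_div hK hε) (√ε * S)
  refine ⟨‖-(2 * √ε)‖₊ * M, fun s hs x => ?_⟩
  rw [rescaledVelocity, norm_smul]
  push_cast
  gcongr
  exact hM _ (abs_sqrt_mul_le hs) x

theorem continuous_rescaledVelocity (hK : LipschitzWith K φ) (hε : 0 < ε)
    (x : EuclideanSpace ℝ (Fin d)) : Continuous (fun s => rescaledVelocity φ ε s x) := by
  have h := (continuous_gaussMean (lipschitzWith_neg_div hK hε) x).comp (continuous_const_mul √ε)
  change Continuous fun s => -(2 * √ε) • gaussMean (fun y => -φ y / ε) (√ε * s) x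
  exact h.const_smul (-(2 * √ε))

theorem IsLagrangianFlow.isTrajectory (hY : IsLagrangianFlow φ ε Y) (hK : LipschitzWith K φ)
    (hε : 0 < ε) (y : EuclideanSpace ℝ (Fin d)) :
    IsTrajectory (rescaledVelocity φ ε) (fun s => Y y (s ^ 2)) where
  continuousOn := (hY.continuousOn y).comp (by fun_prop) fun s _ => sq_nonneg s
  hasDerivAt s hs := by
    rw [rescaledVelocity_eq hK hε hs]
    have h2 : HasDerivAt (fun s : ℝ => s ^ 2) (2 * s) s := by simpa using hasDerivAt_pow 2 s
    exact (hY.hasDerivAt y (s ^ 2) (by positivity)).scomp s h2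

theorem exists_isLagrangianFlow (hK : LipschitzWith K φ) (hε : 0 < ε) :
    ∃ Y, IsLagrangianFlow φ ε Y := by
  choose Z hZ hZ0 using exists_isTrajectory
    (exists_lipschitzWith_rescaledVelocity hK hε)
    (fun x => (continuous_rescaledVelocity hK hε x).continuousOn)
    (exists_norm_rescaledVelocity_le hK hε)
  refine ⟨fun y t => Z y √t, fun y => by simp [hZ0], fun y => ?_, fun y t ht => ?_⟩
  · exact (hZ y).continuousOn.comp (by fun_prop) fun t _ => Real.sqrt_nonneg t
  · have hs : 0 < √t := Real.sqrt_pos.2 ht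
    have h := ((hZ y).hasDerivAt √t hs).scomp t (Real.hasDerivAt_sqrt ht.ne')
    rw [rescaledVelocity_eq hK hε hs, Real.sq_sqrt ht.le, smul_smul,
      one_div_mul_cancel (by positivity), one_smul] at h
    exact h

theorem IsLagrangianFlow.isOrientedBilipschitz (hY : IsLagrangianFlow φ ε Y)
    (hK : LipschitzWith K φ) (hε : 0 < ε) (ht : 0 ≤ t) :
    IsOrientedBilipschitz volume (fun y => Y y t) := by
  have := isOrientedBilipschitz_of_isTrajectory (μ := volume) (hY.isTrajectory hK hε)
    (fun y => by simp [hY.initial]) (exists_lipschitzWith_rescaledVelocity hK hε)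
    (Real.sqrt_nonneg t)
  simpa [Real.sq_sqrt ht] using this

theorem IsLagrangianFlow.measurable (hY : IsLagrangianFlow φ ε Y)
    (hK : LipschitzWith K φ) (hε : 0 < ε) (ht : 0 ≤ t) : Measurable (fun y => Y y t) := by
  obtain ⟨C, hC⟩ := (hY.isOrientedBilipschitz hK hε ht).lipschitz
  exact hC.continuous.measurable

theorem IsLagrangianFlow.norm_sub_le (hY : IsLagrangianFlow φ ε Y) (hK : LipschitzWith K φ)
    (hε : 0 < ε) (ht : 0 ≤ t) (y : EuclideanSpace ℝ (Fin d)) : ‖Y y t - y‖ ≤ K * t := by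
  have := norm_sub_le_of_hasDerivAt_Ioo ht ((hY.continuousOn y).mono fun s hs => hs.1)
    (fun s hs => hY.hasDerivAt y s hs.1) (fun s hs => norm_velocity_le hK hε hs.1 _)
  rwa [hY.initial, sub_zero] at this

/-- Semiconcavity bounds u^ε(b) by the tangent paraboloid at a, and u^δ(a) by the one at b. In the
sum only u^ε - u^δ at the points a and b is left, each at most e in absolute value. -/
theorem inner_velocity_sub_le (hK : LipschitzWith K φ) (hφ : LambdaConcave lam φ) (hε : 0 < ε)
    (hδ : 0 < δ) (ht : 0 < t) {e : ℝ}
    (he : ∀ x, |colePotential φ ε t x - colePotential φ δ t x| ≤ e)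
    (a b : EuclideanSpace ℝ (Fin d)) :
    inner ℝ (a - b) (velocity φ ε t a - velocity φ δ t b) ≤ 2 * e + lam * ‖a - b‖ ^ 2 := by
  have h1 := (hφ.colePotential hK hε ht).le_add_inner (hasFDerivAt_colePotential hK hε ht a) b
  have h2 := (hφ.colePotential hK hδ ht).le_add_inner (hasFDerivAt_colePotential hK hδ ht b) a
  have h3 := abs_le.1 (he a)
  have h4 := abs_le.1 (he b)
  rw [norm_sub_rev, ← neg_sub a b, inner_neg_right, real_inner_comm] at h1
  rw [real_inner_comm] at h2
  rw [inner_sub_right]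
  linarith [h3.2, h4.1]

theorem IsLagrangianFlow.norm_sub_sq_le (hY : IsLagrangianFlow φ ε Y)
    (hY' : IsLagrangianFlow φ δ Y') (hK : LipschitzWith K φ) (hlam : 0 ≤ lam)
    (hφ : LambdaConcave lam φ) (hε : 0 < ε) (hδ : 0 < δ) {e : ℝ} (he0 : 0 ≤ e) (ht : 0 ≤ t)
    (htT : t ≤ T)
    (he : ∀ s, 0 < s → s ≤ T → ∀ x, |colePotential φ ε s x - colePotential φ δ s x| ≤ e)
    (y : EuclideanSpace ℝ (Fin d)) :
    ‖Y y t - Y' y t‖ ^ 2 ≤ Real.exp (2 * lam * T) * (4 * T) * e := by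
  have hsub : Icc 0 t ⊆ Ici (0 : ℝ) := fun s hs => hs.1
  have := le_exp_mul_of_deriv_le (q := fun s => ‖Y y s - Y' y s‖ ^ 2)
    (c := 2 * lam) (m := 4 * e) ht (by positivity) (by positivity)
    (((((hY.continuousOn y).mono hsub).sub ((hY'.continuousOn y).mono hsub)).norm).pow 2)
    (fun s hs => ((hY.hasDerivAt y s hs.1).sub (hY'.hasDerivAt y s hs.1)).norm_sq)
    (fun s hs => by
      have := inner_velocity_sub_le hK hφ hε hδ hs.1 (he s hs.1 (hs.2.le.trans htT))
        (Y y s) (Y' y s)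
      simp only [Pi.sub_apply]
      linarith)
  simp only [hY.initial, hY'.initial, sub_self, norm_zero, sub_zero] at this
  calc ‖Y y t - Y' y t‖ ^ 2 ≤ _ := this
    _ ≤ Real.exp (2 * lam * T) * (4 * T * e) := by
      rw [zero_pow two_ne_zero, zero_add, show 4 * T * e = 4 * e * T by ring]
      gcongr
    _ = _ := by ring

theorem uniformCauchySeqOn_flow (hK : LipschitzWith K φ) (hlam : 0 ≤ lam)
    (hφ : LambdaConcave lam φ)
    {Xeps : ℝ → EuclideanSpace ℝ (Fin d) → ℝ → EuclideanSpace ℝ (Fin d)}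
    (hX : ∀ ε : ℝ, 0 < ε → IsLagrangianFlow φ ε (Xeps ε)) (T : ℝ) :
    UniformCauchySeqOn (fun ε p => Xeps ε p.1 p.2) (𝓝[>] 0)
      ((univ : Set (EuclideanSpace ℝ (Fin d))) ×ˢ Icc 0 T) := by
  obtain ⟨η, hη, hle⟩ := exists_abs_colePotential_sub_hopfLax_le hK T
  intro u hu
  obtain ⟨r, hr, hru⟩ := Metric.mem_uniformity_dist.1 hu
  have hpos : ∀ᶠ ε : ℝ in 𝓝[>] 0, 0 < ε ∧ ε ≤ 1 := by
    filter_upwards [Ioc_mem_nhdsGT one_pos] with ε hε using hε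
  have hlim : Tendsto (fun p : ℝ × ℝ => Real.exp (2 * lam * T) * (4 * T) * (η p.1 + η p.2))
      (𝓝[>] 0 ×ˢ 𝓝[>] 0) (𝓝 0) := by
    simpa using ((hη.comp tendsto_fst).add (hη.comp tendsto_snd)).const_mul
      (Real.exp (2 * lam * T) * (4 * T))
  filter_upwards [hpos.prod_inl (𝓝[>] 0), hpos.prod_inr (𝓝[>] 0),
    hlim.eventually_lt_const (show 0 < r ^ 2 by positivity)] with p hp1 hp2 hp3
  rintro ⟨y, t⟩ ⟨-, ht⟩
  refine hru ?_
  rw [dist_eq_norm]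
  -- The potentials are compared only at positive times, and nonnegativity of the error is read off
  -- at time t; at t = 0 the flows coincide.
  rcases ht.1.eq_or_lt with h0 | h0
  · have ht0 : t = 0 := h0.symm
    simp only [ht0, (hX p.1 hp1.1).initial, (hX p.2 hp2.1).initial, sub_self, norm_zero]
    exact hr
  have hcomp : ∀ s, 0 < s → s ≤ T → ∀ x,
      |colePotential φ p.1 s x - colePotential φ p.2 s x| ≤ η p.1 + η p.2 := by
    intro s hs hsT x
    have h1 := abs_le.1 (hle p.1 s hp1.1 hp1.2 hs hsT x)
    have h2 := abs_le.1 (hle p.2 s hp2.1 hp2.2 hs hsT x)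
    rw [abs_le]
    constructor <;> linarith
  have he0 := (abs_nonneg _).trans (hcomp t h0 ht.2 y)
  have := (hX p.1 hp1.1).norm_sub_sq_le (hX p.2 hp2.1) hK hlam hφ hp1.1 hp2.1 he0 ht.1 ht.2
    hcomp y
  exact lt_of_pow_lt_pow_left₀ 2 hr.le (this.trans_lt hp3)

end Flow

end AdhesionModel

theorem theorem3 {d : ℕ} (φ : EuclideanSpace ℝ (Fin d) → ℝ) (K : ℝ≥0) (lam : ℝ)
    (hK : LipschitzWith K φ) (hlam : 0 ≤ lam) (hφ : AdhesionModel.LambdaConcave lam φ) :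
    -- the viscous Lagrangian flows exist
    (∀ ε : ℝ, 0 < ε → ∃ Y, AdhesionModel.IsLagrangianFlow φ ε Y) ∧
    -- whichever representatives of them (at negative times) are used, they have a limit `X`
    ∀ Xeps : ℝ → EuclideanSpace ℝ (Fin d) → ℝ → EuclideanSpace ℝ (Fin d),
      (∀ ε : ℝ, 0 < ε → AdhesionModel.IsLagrangianFlow φ ε (Xeps ε)) →
      ∃ X : EuclideanSpace ℝ (Fin d) → ℝ → EuclideanSpace ℝ (Fin d),
        (∀ C : Set (EuclideanSpace ℝ (Fin d) × ℝ), IsCompact C → C ⊆ univ ×ˢ Ici 0 →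
          TendstoUniformlyOn (fun ε p => Xeps ε p.1 p.2) (fun p => X p.1 p.2) (𝓝[>] 0) C) ∧
        (∀ t : ℝ, 0 ≤ t → Measurable (fun y => X y t)) ∧
        -- the viscous mass measures are the pushforwards of Lebesgue measure
        (∀ ε : ℝ, 0 < ε → ∀ t : ℝ, 0 ≤ t →
          Measurable (fun y => Xeps ε y t) ∧
          AdhesionModel.viscousMass (fun y => Xeps ε y t) =
            Measure.map (fun y => Xeps ε y t) volume) ∧
        -- all the measures are locally finite
        (∀ ε : ℝ, 0 < ε → ∀ t : ℝ, 0 ≤ t →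
          IsLocallyFiniteMeasure (AdhesionModel.viscousMass (fun y => Xeps ε y t))) ∧
        (∀ t : ℝ, 0 ≤ t → IsLocallyFiniteMeasure (Measure.map (fun y => X y t) volume)) ∧
        -- (i) zero-viscosity limit
        (∀ t : ℝ, 0 ≤ t →
          AdhesionModel.LocallyWeakStarTendsto
            (fun ε => AdhesionModel.viscousMass (fun y => Xeps ε y t))
            (Measure.map (fun y => X y t) volume)) ∧
        -- (ii) initial trace
        AdhesionModel.LocallyWeakStarTendsto
          (fun t => Measure.map (fun y => X y t) volume) volume := by
  refine ⟨fun ε hε => AdhesionModel.exists_isLagrangianFlow hK hε, fun Xeps hX => ?_⟩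
  have hcauchy := AdhesionModel.uniformCauchySeqOn_flow hK hlam hφ hX
  have hlim : ∀ y, ∀ t : ℝ, ∃ x, 0 ≤ t → Tendsto (fun ε => Xeps ε y t) (𝓝[>] 0) (𝓝 x) := by
    intro y t
    by_cases ht : 0 ≤ t
    · have := (hcauchy t).cauchy_map (x := (y, t)) ⟨mem_univ y, ht, le_rfl⟩
      obtain ⟨x, hx⟩ := cauchy_map_iff_exists_tendsto.1 this
      exact ⟨x, fun _ => hx⟩
    -- An arbitrary value at negative times, where the flows are unconstrained.
    · exact ⟨0, fun h => absurd h ht⟩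
  choose X hXlim using hlim
  have hmeas : ∀ ε : ℝ, 0 < ε → ∀ t : ℝ, 0 ≤ t → Measurable (fun y => Xeps ε y t) :=
    fun ε hε t ht => (hX ε hε).measurable hK hε ht
  have hXmeas : ∀ t : ℝ, 0 ≤ t → Measurable (fun y => X y t) := by
    intro t ht
    have hseq : Tendsto (fun n : ℕ => 1 / ((n : ℝ) + 1)) atTop (𝓝[>] 0) :=
      tendsto_nhdsWithin_iff.2 ⟨tendsto_one_div_add_atTop_nhds_zero_nat,
        Eventually.of_forall fun n => mem_Ioi.2 Nat.one_div_pos_of_nat⟩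
    exact measurable_of_tendsto_metrizable
      (fun n : ℕ => hmeas (1 / ((n : ℝ) + 1)) Nat.one_div_pos_of_nat t ht)
      (tendsto_pi_nhds.2 fun y => (hXlim y t ht).comp hseq)
  have hdisp : ∀ t : ℝ, 0 ≤ t → ∀ y, ‖X y t - y‖ ≤ K * t := fun t ht y =>
    le_of_tendsto ((hXlim y t ht).sub_const y).norm (by
      filter_upwards [self_mem_nhdsWithin] with ε hε
      exact (hX ε hε).norm_sub_le hK hε ht y)
  have hmass : ∀ ε : ℝ, 0 < ε → ∀ t : ℝ, 0 ≤ t →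
      AdhesionModel.viscousMass (fun y => Xeps ε y t) =
        Measure.map (fun y => Xeps ε y t) volume := fun ε hε t ht =>
    AdhesionModel.viscousMass_eq_map ((hX ε hε).isOrientedBilipschitz hK hε ht)
  have hmap : ∀ F : EuclideanSpace ℝ (Fin d) → EuclideanSpace ℝ (Fin d), Measurable F →
      ∀ g : EuclideanSpace ℝ (Fin d) → ℝ, Continuous g →
        ∫ x, g x ∂(Measure.map F volume) = ∫ y, g (F y) := fun F hF g hg =>
    integral_map hF.aemeasurable hg.aestronglyMeasurable
  refine ⟨X, ?_, hXmeas, fun ε hε t ht => ⟨hmeas ε hε t ht, hmass ε hε t ht⟩, ?_, ?_, ?_, ?_⟩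
  · intro C hC hCsub
    -- Compactness is used only to bound the times; the convergence is uniform in y over the whole
    -- space.
    obtain ⟨T, hT⟩ := (hC.image continuous_snd).bddAbove
    refine ((hcauchy T).tendstoUniformlyOn_of_tendsto ?_).mono (fun p hp =>
      ⟨mem_univ _, (hCsub hp).2, hT (mem_image_of_mem _ hp)⟩)
    exact fun p hp => hXlim p.1 p.2 hp.2.1
  · intro ε hε t ht
    rw [hmass ε hε t ht]
    exact AdhesionModel.isLocallyFiniteMeasure_map_of_norm_sub_le (hmeas ε hε t ht)
      ((hX ε hε).norm_sub_le hK hε ht)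
  · exact fun t ht => AdhesionModel.isLocallyFiniteMeasure_map_of_norm_sub_le (hXmeas t ht)
      (hdisp t ht)
  · intro t ht g hg hgc
    rw [hmap _ (hXmeas t ht) g hg]
    refine (AdhesionModel.tendsto_integral_comp_of_norm_sub_le (μ := volume) (R := K * t)
      (F := fun ε y => Xeps ε y t) ?_ ?_ (fun y => hXlim y t ht) hg hgc).congr' ?_
    · filter_upwards [self_mem_nhdsWithin] with ε hε using hmeas ε hε t ht
    · filter_upwards [self_mem_nhdsWithin] with ε hε using (hX ε hε).norm_sub_le hK hε ht
    · filter_upwards [self_mem_nhdsWithin] with ε hε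
      rw [hmass ε hε t ht, hmap _ (hmeas ε hε t ht) g hg]
  · intro g hg hgc
    refine (AdhesionModel.tendsto_integral_comp_of_norm_sub_le (μ := volume) (R := K)
      (F := fun t y => X y t) (G := fun y => y) (l := 𝓝[>] (0 : ℝ)) ?_ ?_ ?_ hg hgc).congr' ?_
    · filter_upwards [self_mem_nhdsWithin] with t ht using hXmeas t (le_of_lt ht)
    -- For t ≤ 1 the displacement Kt is at most K, so one radius serves all small times.
    · filter_upwards [Ioc_mem_nhdsGT one_pos] with t ht y
      exact (hdisp t ht.1.le y).trans (mul_le_of_le_one_right K.2 ht.2)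
    · intro y
      rw [tendsto_iff_norm_sub_tendsto_zero]
      have h0 : Tendsto (fun t : ℝ => K * t) (𝓝[>] 0) (𝓝 0) := by
        simpa using ((continuous_const_mul (K : ℝ)).tendsto 0).mono_left nhdsWithin_le_nhds
      refine squeeze_zero' (Eventually.of_forall fun t => norm_nonneg _) ?_ h0
      filter_upwards [self_mem_nhdsWithin] with t ht using hdisp t (le_of_lt ht) y
    · filter_upwards [self_mem_nhdsWithin] with t ht
      rw [hmap _ (hXmeas t (le_of_lt ht)) g hg]
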